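/- \textbf{Model.} A machine has $K\ge 1$ arms. Pulling arm $i$ costs a known amount $c_i\ge 1$ and yields an independent reward from a distribution $\nu_i$ on $[0,1]$ with mean $\mu_i$. An algorithm chooses at every step, possibly at random and based on the past pulls and rewards, an arm or no pull at all; it respects the budget $B$ if almost surely $\sum_i N_i c_i\le B$, where $N_i$ is the total number of pulls of arm $i$. $G(A)$ is the total reward of algorithm $A$, and its regret is $R(A)=\sup_{A'}\mathbf E[G(A')]-\mathbf E[G(A)]$, the supremum being over all algorithms $A'$ that respect the budget $B$. \textbf{KUBE.} Let $c_{\min}=\min_j c_j$, $c_{\max}=\max_j c_j$, and let $B_t$ be the residual budget at step $t=1,2,\dots$ ($B_1=B$). If $B_t<c_{\min}$, KUBE stops. Otherwise, if $t\le K$, it pulls arm $t$ (it makes no pull at this step if $c_t>B_t$). Otherwise, let $\hat\mu_i$ be the average of the $n_i$ rewards received so far from arm $i$, and consider the unbounded knapsack problem of maximising $\sum_i m_i\bigl(\hat\mu_i+\sqrt{2\ln t/n_i}\bigr)$ over non-negative integers $m_i$ with $\sum_i m_ic_i\le B_t$. Its density-ordered greedy solution $(m_i^*)$ runs through the arms in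 an order of non-increasing density $\bigl(\hat\mu_i+\sqrt{2\ln t/n_i}\bigr)/c_i$ (ties broken arbitrarily), taking of each as many units as still fit. KUBE pulls arm $i$ with probability $m_i^*/\sum_k m_k^*$. (An arm with $n_i=0$ at this stage no longer fits in the budget, so $m_i^*=0$.) \textbf{Theorem.} Assume that the arm $I^*$ maximising $\mu_i/c_i$ is unique. Put $d_{\min}=\min_{j\ne I^*}\bigl(\mu_{I^*}/c_{I^*}-\mu_j/c_j\bigr)$, $\Delta_j=\mu_{I^*}-\mu_j$, $\delta_j=c_j-c_{I^*}$. For every budget $B\ge c_{\min}$, KUBE respects the budget, the supremum in the definition of the regret is finite, and $$R(\mathrm{KUBE})\le\left(\frac{8}{d_{\min}^2}+\Bigl(\frac{c_{\max}}{c_{\min}}\Bigr)^2\right)\left(\sum_{\Delta_j>0}\Delta_j+\sum_{\delta_j>0}\frac{\delta_j}{c_{I^*}}\right)\ln\frac{B}{c_{\min}}+\left(\sum_{\Delta_j>0}\Delta_j+\sum_{\delta_j>0}\frac{\delta_j}{c_{I^*}}\right)\left(\frac{\pi^2}{3}+1\right)+1 .$$ (For $K=1$ both sums are empty and the bound is $1$.)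 In particular, for a fixed machine, $R(\mathrm{KUBE})=O(\ln B)$ as $B\to\infty$. -/

import Mathlib

open MeasureTheory ProbabilityTheory Finset
open scoped ENNReal

namespace BudgetBandit

noncomputable section

/-! ### The budget-limited bandit: interaction between an algorithm and the machine -/

/-- What is done in one step: `some i` is a pull of arm `i`, `none` means that no arm is pulled
(an algorithm that has stopped does nothing in all later steps). -/
abbrev Action (K : ℕ) : Type := Option (Fin K)

instance instMeasurableSpaceAction (K : ℕ) : MeasurableSpace (Action K) := ⊤

instance instDiscreteMeasurableSpaceAction (K : ℕ) : DiscreteMeasurableSpace (Action K) :=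
  ⟨fun _ => trivial⟩

/-- The record of one step: the action and the reward received (`0` if no arm is pulled). -/
abbrev Obs (K : ℕ) : Type := Action K × ℝ

/-- The records at the times `0, 1, …, n`. The entry at time `0` is a dummy starting value; the
steps proper are numbered `1, 2, …`, so this is the history known when step `n + 1` begins. -/
abbrev History (K n : ℕ) : Type := (s : Finset.Iic n) → Obs K

/-- A (possibly randomised) arm-pulling algorithm: for every `n`, the conditional distribution of
the action of step `n + 1` given the history up to step `n`. -/
structure Algorithm (K : ℕ) where
  choose : (n : ℕ) → Kernel (History K n) (Action K)
  markov : ∀ n, IsMarkovKernel (choose n)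

instance instMarkovChoose {K : ℕ} (A : Algorithm K) (n : ℕ) : IsMarkovKernel (A.choose n) :=
  A.markov n

/-- Distribution of the reward given the action: `ν i` for a pull of arm `i`. -/
def rewardMeasure {K : ℕ} (ν : Fin K → Measure ℝ) : Action K → Measure ℝ
  | some i => ν i
  | none => Measure.dirac 0

def rewardKernel {K : ℕ} (ν : Fin K → Measure ℝ) : Kernel (Action K) ℝ :=
  Kernel.ofFunOfCountable (rewardMeasure ν)

instance instMarkovReward {K : ℕ} (ν : Fin K → Measure ℝ) [∀ i, IsProbabilityMeasure (ν i)] :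
    IsMarkovKernel (rewardKernel ν) := by
  refine ⟨fun a => ?_⟩
  cases a with
  | none => exact (inferInstance : IsProbabilityMeasure (Measure.dirac (0 : ℝ)))
  | some i => exact (inferInstance : IsProbabilityMeasure (ν i))

/-- The conditional distribution of the record of step `n + 1` given the history: the algorithm
chooses an action, then a reward is drawn from the distribution of the chosen arm. -/
def stepKernel {K : ℕ} (ν : Fin K → Measure ℝ) (A : Algorithm K) (n : ℕ) :
    Kernel (History K n) (Obs K) :=
  A.choose n ⊗ₖ (rewardKernel ν).comap Prod.snd measurable_snd

instance instMarkovStep {K : ℕ} (ν : Fin K → Measure ℝ) [∀ i, IsProbabilityMeasure (ν i)]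
    (A : Algorithm K) (n : ℕ) : IsMarkovKernel (stepKernel ν A n) := by
  unfold stepKernel; infer_instance

/-- The law of the sequence of records when `A` plays the machine with reward distributions `ν`. -/
def law {K : ℕ} (ν : Fin K → Measure ℝ) [∀ i, IsProbabilityMeasure (ν i)] (A : Algorithm K) :
    Measure (ℕ → Obs K) :=
  Kernel.traj (X := fun _ => Obs K) (stepKernel ν A) 0 (fun _ => (none, 0))

/-- Total number of pulls of arm `i`. -/
def numPulls {K : ℕ} (i : Fin K) (ω : ℕ → Obs K) : ℝ≥0∞ :=
  ∑' t : ℕ, if (ω (t + 1)).1 = some i then 1 else 0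

/-- Total reward (the rewards are non-negative). -/
def totalReward {K : ℕ} (ω : ℕ → Obs K) : ℝ≥0∞ :=
  ∑' t : ℕ, ENNReal.ofReal (ω (t + 1)).2

/-- Almost surely, the total cost of all pulls does not exceed the budget `B`. -/
def RespectsBudget {K : ℕ} (c : Fin K → ℝ) (ν : Fin K → Measure ℝ)
    [∀ i, IsProbabilityMeasure (ν i)] (B : ℝ) (A : Algorithm K) : Prop :=
  ∀ᵐ ω ∂(law ν A), ∑ i, numPulls i ω * ENNReal.ofReal (c i) ≤ ENNReal.ofReal B

/-- `E[G(A)]`. -/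
def expectedReward {K : ℕ} (ν : Fin K → Measure ℝ) [∀ i, IsProbabilityMeasure (ν i)]
    (A : Algorithm K) : ℝ≥0∞ :=
  ∫⁻ ω, totalReward ω ∂(law ν A)

/-- `E[G(A*)]`: the best expected total reward among all algorithms that respect the budget
(algorithms may depend on the reward distributions `ν`). -/
def optimalReward {K : ℕ} (c : Fin K → ℝ) (ν : Fin K → Measure ℝ)
    [∀ i, IsProbabilityMeasure (ν i)] (B : ℝ) : ℝ≥0∞ :=
  ⨆ (A : Algorithm K) (_ : RespectsBudget c ν B A), expectedReward ν A

/-- `R(A) = E[G(A*)] - E[G(A)]`. -/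
def regret {K : ℕ} (c : Fin K → ℝ) (ν : Fin K → Measure ℝ)
    [∀ i, IsProbabilityMeasure (ν i)] (B : ℝ) (A : Algorithm K) : ℝ :=
  (optimalReward c ν B).toReal - (expectedReward ν A).toReal

/-! ### The KUBE algorithm -/

/-- Number of pulls of arm `i` in a history. -/
def pullCount {K n : ℕ} (h : History K n) (i : Fin K) : ℕ :=
  #{s : Finset.Iic n | (h s).1 = some i}

/-- Sum of the rewards received from arm `i` in a history. -/
def rewardSum {K n : ℕ} (h : History K n) (i : Fin K) : ℝ :=
  ∑ s : Finset.Iic n, if (h s).1 = some i then (h s).2 else 0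

/-- The residual budget after a history. -/
def residual {K n : ℕ} (c : Fin K → ℝ) (B : ℝ) (h : History K n) : ℝ :=
  B - ∑ i, (pullCount h i : ℝ) * c i

/-- Upper confidence bound of arm `i` at time step `t = n + 1`: average reward received so far plus
`√(2 ln t / n_i)`. -/
def ucb {K n : ℕ} (h : History K n) (i : Fin K) : ℝ :=
  rewardSum h i / pullCount h i + √(2 * Real.log ((n : ℝ) + 1) / pullCount h i)

/-- `m` is a density-ordered greedy solution of the unbounded knapsack problem with item values `v`,
weights `c` and capacity `C`: the types are taken in an order `σ` of non-increasing density
`v i / c i` (ties in any order), and of each type in turn as many units as still fit are taken. -/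
def IsGreedySolution {K : ℕ} (c v : Fin K → ℝ) (C : ℝ) (m : Fin K → ℕ) : Prop :=
  ∃ σ : Equiv.Perm (Fin K),
    Antitone (fun k => v (σ k) / c (σ k)) ∧
    ∀ k, m (σ k) = ⌊(C - ∑ l ∈ Finset.univ.filter (· < k), (m (σ l) : ℝ) * c (σ l)) / c (σ k)⌋₊

/-- Smallest pulling cost. -/
def costMin {K : ℕ} (c : Fin K → ℝ) : ℝ := ⨅ i, c i

/-- Largest pulling cost. -/
def costMax {K : ℕ} (c : Fin K → ℝ) : ℝ := ⨆ i, c i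

/-- `A` is KUBE with costs `c` and budget `B`. In step `t = n + 1`, with residual budget `B_t`:
* if `B_t < c_min`, no arm is pulled;
* otherwise, if `t ≤ K`, the `t`-th arm is pulled (provided that it can be paid for);
* otherwise, arm `i` is pulled with probability `m i / ∑ k, m k`, for a density-ordered greedy
  solution `m` of the knapsack problem with the upper confidence bounds as values and capacity
  `B_t`. -/
def IsKUBE {K : ℕ} (c : Fin K → ℝ) (B : ℝ) (A : Algorithm K) : Prop :=
  ∀ (n : ℕ) (h : History K n),
    (residual c B h < costMin c → A.choose n h = Measure.dirac none) ∧
    (costMin c ≤ residual c B h → ∀ i : Fin K, (i : ℕ) = n →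
      A.choose n h = Measure.dirac (if c i ≤ residual c B h then some i else none)) ∧
    (costMin c ≤ residual c B h → K ≤ n →
      ∃ m : Fin K → ℕ, IsGreedySolution c (ucb h) (residual c B h) m ∧
        ∀ i, A.choose n h {some i} = ENNReal.ofReal ((m i : ℝ) / ∑ k, (m k : ℝ)))

/-! ### The problem-dependent quantities -/

/-- True mean reward of arm `i`. -/
def mean {K : ℕ} (ν : Fin K → Measure ℝ) (i : Fin K) : ℝ := ∫ x, x ∂(ν i)

/-- `d_min`: smallest difference between the density of the arm `I` and that of another arm. -/
def densityGap {K : ℕ} (c : Fin K → ℝ) (ν : Fin K → Measure ℝ) (I : Fin K) : ℝ :=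
  ⨅ j : {j : Fin K // j ≠ I}, (mean ν I / c I - mean ν j / c j)

/-- `∑_{Δ_j > 0} Δ_j + ∑_{δ_j > 0} δ_j / c_I`, with `Δ_j = μ_I - μ_j` and `δ_j = c_j - c_I`. -/
def gapSum {K : ℕ} (c : Fin K → ℝ) (ν : Fin K → Measure ℝ) (I : Fin K) : ℝ :=
  ∑ j ∈ Finset.univ.filter (fun j => 0 < mean ν I - mean ν j), (mean ν I - mean ν j) +
    ∑ j ∈ Finset.univ.filter (fun j => 0 < c j - c I), (c j - c I) / c I

end

end BudgetBandit

namespace BudgetBandit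
noncomputable section

/-! ### KUBE exists -/

/-- Capacity left before the `k`-th type in the order `σ` is considered. -/
def capLeft {K : ℕ} (c : Fin K → ℝ) (σ : Equiv.Perm (Fin K)) (C : ℝ) : ℕ → ℝ
  | 0 => C
  | k + 1 => if hk : k < K then
      capLeft c σ C k - (⌊capLeft c σ C k / c (σ ⟨k, hk⟩)⌋₊ : ℝ) * c (σ ⟨k, hk⟩)
    else capLeft c σ C k

/-- The greedy solution for the order `σ`. -/
def greedyCount {K : ℕ} (c : Fin K → ℝ) (σ : Equiv.Perm (Fin K)) (C : ℝ) (i : Fin K) : ℕ :=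
  ⌊capLeft c σ C (σ.symm i) / c i⌋₊

theorem capLeft_eq {K : ℕ} (c : Fin K → ℝ) (σ : Equiv.Perm (Fin K)) (C : ℝ) (n : ℕ)
    (hn : n ≤ K) :
    C - ∑ l ∈ Finset.univ.filter (fun l : Fin K => (l : ℕ) < n),
      (greedyCount c σ C (σ l) : ℝ) * c (σ l) = capLeft c σ C n := by
  induction n with
  | zero => simp [capLeft]
  | succ k ih =>
    have hk : k < K := hn
    have hfil : Finset.univ.filter (fun l : Fin K => (l : ℕ) < k + 1) =
        insert (⟨k, hk⟩ : Fin K) (Finset.univ.filter (fun l : Fin K => (l : ℕ) < k)) := by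
      ext l
      simp [Fin.ext_iff]
      omega
    rw [hfil, Finset.sum_insert (by simp)]
    have := ih hk.le
    simp only [capLeft, dif_pos hk]
    rw [← sub_sub, sub_right_comm, this]
    simp [greedyCount]

theorem greedyCount_isGreedySolution {K : ℕ} (c v : Fin K → ℝ) (C : ℝ) :
    IsGreedySolution c v C
      (greedyCount c (Tuple.sort (fun i => -(v i / c i))) C) := by
  refine ⟨Tuple.sort (fun i => -(v i / c i)), ?_, fun k => ?_⟩
  · intro a b hab
    have := Tuple.monotone_sort (fun i => -(v i / c i)) hab
    simpa using this
  · have := capLeft_eq c (Tuple.sort (fun i => -(v i / c i))) C k k.2.le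
    have h2 : (Finset.univ.filter (fun l : Fin K => (l : ℕ) < (k : ℕ))) =
        Finset.univ.filter (· < k) := by
      ext l; simp
    rw [h2] at this
    rw [this]
    simp [greedyCount]

theorem greedy_pos {K : ℕ} (c v : Fin K → ℝ) (hc : ∀ i, 0 < c i) (C : ℝ) (m : Fin K → ℕ)
    (hm : IsGreedySolution c v C m) (i : Fin K) (hi : c i ≤ C) : 0 < ∑ k, m k := by
  by_contra hcon
  have h0 : ∀ k, m k = 0 := by simpa using hcon
  obtain ⟨σ, -, h⟩ := hm
  have := h (σ.symm i)
  simp only [h0, Equiv.apply_symm_apply, Nat.cast_zero, zero_mul, Finset.sum_const_zero,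
    sub_zero] at this
  have h1 : 1 ≤ ⌊C / c i⌋₊ := by
    rw [Nat.one_le_floor_iff, le_div_iff₀ (hc i)]
    simpa using hi
  omega

theorem exists_costMin_eq {K : ℕ} [Nonempty (Fin K)] (c : Fin K → ℝ) : ∃ i, c i = costMin c :=
  exists_eq_ciInf_of_finite

theorem measurable_pullCount {K n : ℕ} (i : Fin K) :
    Measurable (fun h : History K n => pullCount h i) := by
  have : (fun h : History K n => pullCount h i) =
      fun h => ∑ s : Finset.Iic n, if (h s).1 = some i then 1 else 0 := by
    ext h; simp [pullCount]
  rw [this]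
  refine Finset.measurable_sum _ fun s _ => ?_
  exact Measurable.ite ((measurableSet_singleton (some i)).preimage
    (measurable_fst.comp (measurable_pi_apply s))) measurable_const measurable_const

theorem measurable_rewardSum {K n : ℕ} (i : Fin K) :
    Measurable (fun h : History K n => rewardSum h i) := by
  refine Finset.measurable_sum _ fun s _ => ?_
  exact Measurable.ite ((measurableSet_singleton (some i)).preimage
    (measurable_fst.comp (measurable_pi_apply s)))
    (measurable_snd.comp (measurable_pi_apply s)) measurable_const

theorem measurable_cast_pullCount {K n : ℕ} (i : Fin K) :
    Measurable (fun h : History K n => (pullCount h i : ℝ)) :=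
  (measurable_from_top (f := fun k : ℕ => (k : ℝ))).comp (measurable_pullCount i)

theorem measurable_residual {K n : ℕ} (c : Fin K → ℝ) (B : ℝ) :
    Measurable (fun h : History K n => residual c B h) := by
  unfold residual
  exact measurable_const.sub (Finset.measurable_sum _ fun i _ =>
    (measurable_cast_pullCount i).mul_const _)

theorem measurable_ucb {K n : ℕ} (i : Fin K) :
    Measurable (fun h : History K n => ucb h i) := by
  unfold ucb
  exact ((measurable_rewardSum i).div (measurable_cast_pullCount i)).add
    ((measurable_const.div (measurable_cast_pullCount i)).sqrt)

theorem measurableSet_sort_eq {K : ℕ} {X : Type*} [MeasurableSpace X] (f : X → Fin K → ℝ)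
    (hf : ∀ i, Measurable (fun x => f x i)) (σ : Equiv.Perm (Fin K)) :
    MeasurableSet {x | Tuple.sort (f x) = σ} := by
  have : {x | Tuple.sort (f x) = σ} =
      {x | (∀ i j, i ≤ j → f x (σ i) ≤ f x (σ j)) ∧
        ∀ i j, i < j → f x (σ i) = f x (σ j) → σ i < σ j} := by
    ext x
    exact eq_comm.trans Tuple.eq_sort_iff
  rw [this]
  refine MeasurableSet.inter ?_ ?_
  · exact measurableSet_setOfPred.2 (Measurable.forall fun i => Measurable.forall fun j =>
      Measurable.forall fun _ => measurableSet_setOfPred.1 (measurableSet_le (hf _) (hf _)))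
  · refine measurableSet_setOfPred.2 (Measurable.forall fun i => Measurable.forall fun j =>
      Measurable.forall fun _ => measurableSet_setOfPred.1 ?_)
    have h1 : {x | f x (σ i) = f x (σ j) → σ i < σ j} =
      {x | f x (σ i) = f x (σ j)}ᶜ ∪ {_x | σ i < σ j} := by
      ext x; simp [imp_iff_not_or]
    rw [h1]
    exact (measurableSet_eq_fun (hf _) (hf _)).compl.union (MeasurableSet.const _)

theorem measurable_capLeft {K n : ℕ} (c : Fin K → ℝ) (B : ℝ) (σ : Equiv.Perm (Fin K)) (k : ℕ) :
    Measurable (fun h : History K n => capLeft c σ (residual c B h) k) := by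
  induction k with
  | zero => simpa [capLeft] using measurable_residual c B
  | succ k ih =>
    by_cases hk : k < K
    · simp only [capLeft, dif_pos hk]
      exact ih.sub (((measurable_from_top (f := fun k : ℕ => (k : ℝ))).comp
        (Nat.measurable_floor.comp (ih.div_const _))).mul_const _)
    · simpa only [capLeft, dif_neg hk] using ih

/-- Integer weights proportional to the probabilities with which KUBE chooses its action. -/
def kubeWeight {K : ℕ} (c : Fin K → ℝ) (B : ℝ) (n : ℕ) (h : History K n) (a : Action K) : ℕ :=
  if residual c B h < costMin c then (if a = none then 1 else 0)
  else if hn : n < K then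
    (if a = (if c ⟨n, hn⟩ ≤ residual c B h then some ⟨n, hn⟩ else none) then 1 else 0)
  else a.elim 0 (greedyCount c (Tuple.sort (fun i => -(ucb h i / c i))) (residual c B h))

theorem measurable_kubeWeight {K : ℕ} (c : Fin K → ℝ) (B : ℝ) (n : ℕ) :
    Measurable (kubeWeight c B n) := by
  refine measurable_pi_iff.2 fun a => ?_
  have hr := measurable_residual (n := n) c B
  refine Measurable.ite (measurableSet_lt hr measurable_const) measurable_const ?_
  by_cases hn : n < K
  · simp only [dif_pos hn]
    have : ∀ h : History K n,
        (if a = (if c ⟨n, hn⟩ ≤ residual c B h then some ⟨n, hn⟩ else none) then 1 else 0 : ℕ) =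
        if c ⟨n, hn⟩ ≤ residual c B h then (if a = some ⟨n, hn⟩ then 1 else 0)
        else (if a = none then 1 else 0) := by
      intro h; split_ifs <;> simp_all
    simp only [this]
    exact Measurable.ite (measurableSet_le measurable_const hr) measurable_const measurable_const
  · simp only [dif_neg hn]
    cases a with
    | none => exact measurable_const
    | some i =>
      simp only [Option.elim]
      refine measurable_to_countable' fun y => ?_
      have : ((fun h : History K n => greedyCount c (Tuple.sort (fun i => -(ucb h i / c i)))
          (residual c B h) i) ⁻¹' {y}) = ⋃ σ : Equiv.Perm (Fin K),
            ({h | Tuple.sort (fun i => -(ucb h i / c i)) = σ} ∩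
              {h | greedyCount c σ (residual c B h) i = y}) := by
        ext h; simp
      rw [this]
      refine MeasurableSet.iUnion fun σ => ?_
      refine (measurableSet_sort_eq _ (fun i => ((measurable_ucb i).div_const _).neg) σ).inter ?_
      have hm : Measurable (fun h : History K n => greedyCount c σ (residual c B h) i) :=
        Nat.measurable_floor.comp ((measurable_capLeft c B σ _).div_const _)
      exact hm (measurableSet_singleton y)

/-- The probability measure on the actions with the given weights. -/
def weightMeasure {K : ℕ} (w : Action K → ℕ) : Measure (Action K) :=
  if ∑ a, w a = 0 then Measure.dirac none
  else ∑ a, ENNReal.ofReal ((w a : ℝ) / ∑ b, (w b : ℝ)) • Measure.dirac a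

theorem weightMeasure_apply {K : ℕ} (w : Action K → ℕ) (hw : ∑ a, w a ≠ 0) (a : Action K) :
    weightMeasure w {a} = ENNReal.ofReal ((w a : ℝ) / ∑ b, (w b : ℝ)) := by
  rw [weightMeasure, if_neg hw, Measure.finsetSum_apply]
  simp only [Measure.smul_apply, Measure.dirac_apply, smul_eq_mul, Set.indicator,
    Set.mem_singleton_iff, Pi.one_apply, mul_ite, mul_one, mul_zero]
  exact (Finset.sum_ite_eq' Finset.univ a _).trans (if_pos (Finset.mem_univ a))

instance instProbWeight {K : ℕ} (w : Action K → ℕ) : IsProbabilityMeasure (weightMeasure w) := by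
  by_cases hw : ∑ a, w a = 0
  · rw [weightMeasure, if_pos hw]; infer_instance
  · refine ⟨?_⟩
    rw [weightMeasure, if_neg hw, Measure.finsetSum_apply]
    simp only [Measure.smul_apply, measure_univ, smul_eq_mul, mul_one]
    rw [← ENNReal.ofReal_sum_of_nonneg (fun _ _ => by positivity), ← Finset.sum_div, div_self,
      ENNReal.ofReal_one]
    exact_mod_cast hw

theorem weightMeasure_single {K : ℕ} (b : Action K) :
    weightMeasure (fun a => if a = b then 1 else 0) = Measure.dirac b := by
  rw [weightMeasure, if_neg (by simp)]
  rw [Finset.sum_eq_single b (by intro a _ hab; simp [hab]) (by simp)]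
  simp

/-- KUBE, with ties in the density order broken in favour of the arm with the smaller index. -/
def kubeAlgorithm {K : ℕ} (c : Fin K → ℝ) (B : ℝ) : Algorithm K where
  choose n := (Kernel.ofFunOfCountable weightMeasure).comap (kubeWeight c B n)
    (measurable_kubeWeight c B n)
  markov n := ⟨fun h => instProbWeight (kubeWeight c B n h)⟩

theorem kubeAlgorithm_isKUBE {K : ℕ} [Nonempty (Fin K)] (c : Fin K → ℝ) (hc : ∀ i, 0 < c i)
    (B : ℝ) : IsKUBE c B (kubeAlgorithm c B) := by
  intro n h
  have hch : (kubeAlgorithm c B).choose n h = weightMeasure (kubeWeight c B n h) := rfl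
  rw [hch]
  refine ⟨fun hr => ?_, fun hr i hi => ?_, fun hr hn => ?_⟩
  · have : kubeWeight c B n h = fun a => if a = none then 1 else 0 := by
      ext a; simp [kubeWeight, hr]
    rw [this, weightMeasure_single]
  · subst hi
    have : kubeWeight c B i h =
        fun a => if a = (if c i ≤ residual c B h then some i else none) then 1 else 0 := by
      ext a; simp [kubeWeight, hr.not_gt]
    rw [this, weightMeasure_single]
  · set m := greedyCount c (Tuple.sort (fun i => -(ucb h i / c i))) (residual c B h) with hm
    have hg : IsGreedySolution c (ucb h) (residual c B h) m := greedyCount_isGreedySolution _ _ _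
    have hw : kubeWeight c B n h = fun a : Action K => a.elim 0 m := by
      ext a; simp [kubeWeight, hr.not_gt, hn.not_gt, hm]
    obtain ⟨i₀, hi₀⟩ := exists_costMin_eq c
    have hpos := greedy_pos c _ hc _ m hg i₀ (hi₀ ▸ hr)
    refine ⟨m, hg, fun i => ?_⟩
    rw [hw, weightMeasure_apply]
    · simp [Fintype.sum_option]
    · rw [Fintype.sum_option]
      simpa only [Option.elim, zero_add] using hpos.ne'

end
end BudgetBandit

/-! Write D = μ_I/c_I for the best density. Conditioning on the history step by step gives E[G] = Σ
μ_i E[N_i] for every algorithm (`expectedReward_eq`), and μ_i ≤ D c_i, so nobody within the budget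
earns more than D B. KUBE almost surely ends with less than c_min unspent. Its regret is therefore
at most D c_min + Σ_j E[N_j] (D c_j - μ_j). Here D c_min ≤ μ_I ≤ 1, and D c_j - μ_j = Δ_j + D δ_j
with D ≤ 1/c_I, which produces the two gap sums. What remains is to bound E[N_j] for j ≠ I
(`lintegral_numPulls_le`).

The pulls of such an arm j are split into three groups. Those made while j has few pulls number at
most about 8 ln(B/c_min)/d_min². Those made while j is not of maximal estimated density, or while
some arm is already too expensive, are rare: the first arm in the greedy order fills the knapsack up
to less than its own cost, so j has probability at most (c_max/c_min)² / (B_t/c_min)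
(`IsGreedySolution.div_sum_le`). As each late pull lowers B_t by at least c_min, these probabilities
add up like a harmonic series, which a logarithmic potential controls along each path.

For the remaining pulls j beats I in estimated density although it has been sampled often, so one of
the two averages has left its confidence interval (`pullCount_lt_of_ucb_le`). An exponential
supermartingale and a union bound over the number of pulls bound the probability of each deviation
at step t by 1/t² (`law_deviation_le`), which is summable. -/

namespace BudgetBandit

/-! ### The law of the interaction, one step at a time -/

/-- The records of `ω` up to time `n`. -/
def hist {K : ℕ} (n : ℕ) (ω : ℕ → Obs K) : History K n := Preorder.frestrictLe n ω

section Law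

variable {K : ℕ} (ν : Fin K → Measure ℝ) [∀ i, IsProbabilityMeasure (ν i)] (A : Algorithm K)

instance instProbLaw : IsProbabilityMeasure (law ν A) := by
  unfold law; infer_instance

theorem measurable_hist (n : ℕ) : Measurable (hist (K := K) n) :=
  Preorder.measurable_frestrictLe n

/-- The one-step Markov description of the Ionescu-Tulcea measure. Together with the starting value
in `ae_zero`, it is all that is used about how `law` is built. -/
theorem law_map_step (n : ℕ) :
    (law ν A).map (fun ω => (hist n ω, ω (n + 1))) =
      ((law ν A).map (hist n)) ⊗ₘ stepKernel ν A n := by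
  have h := Kernel.partialTraj_compProd_eq_map_traj (X := fun _ => Obs K)
    (κ := stepKernel ν A) (Nat.zero_le n) (x₀ := fun _ => (none, 0))
  have h2 := Kernel.traj_map_frestrictLe_apply (X := fun _ => Obs K)
    (κ := stepKernel ν A) 0 n (fun _ => (none, 0))
  rw [← h2] at h
  exact h.symm

theorem lintegral_step (n : ℕ) {f : History K n × Obs K → ℝ≥0∞} (hf : Measurable f) :
    ∫⁻ ω, f (hist n ω, ω (n + 1)) ∂(law ν A) =
      ∫⁻ ω, ∫⁻ a, ∫⁻ x, f (hist n ω, (a, x)) ∂(rewardMeasure ν a) ∂(A.choose n (hist n ω))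
        ∂(law ν A) := by
  have hm : Measurable fun ω : ℕ → Obs K => (hist n ω, ω (n + 1)) :=
    (measurable_hist n).prodMk (measurable_pi_apply _)
  rw [← lintegral_map (μ := law ν A) hf hm, law_map_step, Measure.lintegral_compProd hf,
    lintegral_map _ (measurable_hist n)]
  · refine lintegral_congr fun ω => ?_
    have hg : Measurable fun o => f (hist n ω, o) := hf.comp measurable_prodMk_left
    rw [stepKernel, Kernel.lintegral_compProd _ _ _ hg]
    rfl
  · exact hf.lintegral_kernel_prod_right'

theorem lintegral_step_action (n : ℕ) {f : History K n × Action K → ℝ≥0∞} (hf : Measurable f) :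
    ∫⁻ ω, f (hist n ω, (ω (n + 1)).1) ∂(law ν A) =
      ∫⁻ ω, ∫⁻ a, f (hist n ω, a) ∂(A.choose n (hist n ω)) ∂(law ν A) := by
  have := lintegral_step ν A n (f := fun p => f (p.1, p.2.1))
    (hf.comp (measurable_fst.prodMk (measurable_fst.comp measurable_snd)))
  rw [this]
  refine lintegral_congr fun ω => lintegral_congr fun a => ?_
  have : IsProbabilityMeasure (rewardMeasure ν a) :=
    (inferInstance : IsMarkovKernel (rewardKernel ν)).isProbabilityMeasure a
  simp

theorem measurableSet_uncurry_action {X : Type*} [MeasurableSpace X] {P : X → Action K → Prop}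
    (hP : ∀ a, MeasurableSet {h | P h a}) : MeasurableSet {p : X × Action K | P p.1 p.2} := by
  have : {p : X × Action K | P p.1 p.2} = ⋃ a, {h | P h a} ×ˢ {a} := by
    ext ⟨h, a⟩; simp
  rw [this]
  exact MeasurableSet.iUnion fun a => (hP a).prod (measurableSet_singleton a)

/-- The exceptional event has conditional probability zero given every history, so it integrates to
zero. This turns the specification of KUBE into statements about almost every path. -/
theorem ae_step_action (n : ℕ) {P : History K n → Action K → Prop}
    (hP : ∀ a, MeasurableSet {h | P h a}) (h : ∀ h, ∀ᵐ a ∂(A.choose n h), P h a) :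
    ∀ᵐ ω ∂(law ν A), P (hist n ω) (ω (n + 1)).1 := by
  have hS := measurableSet_uncurry_action hP
  have hm : Measurable fun ω : ℕ → Obs K => (hist n ω, (ω (n + 1)).1) :=
    (measurable_hist n).prodMk (measurable_fst.comp (measurable_pi_apply _))
  have := lintegral_step_action ν A n
    (f := Set.indicator {p : History K n × Action K | P p.1 p.2}ᶜ 1)
    (measurable_one.indicator hS.compl)
  have h0 : ∀ ω : ℕ → Obs K, ∫⁻ a, Set.indicator {p : History K n × Action K | P p.1 p.2}ᶜ 1
      (hist n ω, a) ∂(A.choose n (hist n ω)) = 0 := by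
    intro ω
    rw [lintegral_eq_zero_iff (measurable_of_countable _)]
    filter_upwards [h (hist n ω)] with a ha
    simp [ha]
  simp only [h0, lintegral_zero] at this
  have hmi : Measurable fun ω : ℕ → Obs K =>
      Set.indicator {p : History K n × Action K | P p.1 p.2}ᶜ (1 : History K n × Action K → ℝ≥0∞)
        (hist n ω, (ω (n + 1)).1) := (measurable_one.indicator hS.compl).comp hm
  rw [lintegral_eq_zero_iff hmi] at this
  filter_upwards [this] with ω hω
  by_contra hcon
  simp [hcon] at hω

/-- Since `E` is decided before the step, conditioning on the history replaces the pull by its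
conditional probability on `E`. -/
theorem lintegral_pull_indicator (n : ℕ) (j : Fin K) {E : Set (History K n)}
    (hE : MeasurableSet E) :
    law ν A {ω | hist n ω ∈ E ∧ (ω (n + 1)).1 = some j} =
      ∫⁻ ω, E.indicator (fun h => A.choose n h {some j}) (hist n ω) ∂(law ν A) := by
  have hS : MeasurableSet (E ×ˢ {(some j : Action K)}) := hE.prod (measurableSet_singleton _)
  have hm : Measurable fun ω : ℕ → Obs K => (hist n ω, (ω (n + 1)).1) :=
    (measurable_hist n).prodMk (measurable_fst.comp (measurable_pi_apply _))
  have := lintegral_step_action ν A n (f := Set.indicator (E ×ˢ {(some j : Action K)}) 1)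
    (measurable_one.indicator hS)
  calc _ = ∫⁻ ω, (Set.indicator (E ×ˢ {(some j : Action K)}) 1) (hist n ω, (ω (n + 1)).1)
        ∂(law ν A) := by
        rw [← lintegral_indicator_one]
        · refine lintegral_congr fun ω => ?_
          have hiff : (hist n ω, (ω (n + 1)).1) ∈ E ×ˢ {(some j : Action K)} ↔
            hist n ω ∈ E ∧ (ω (n + 1)).1 = some j := Iff.rfl
          by_cases h : hist n ω ∈ E ∧ (ω (n + 1)).1 = some j
          · rw [Set.indicator_of_mem (hiff.2 h), Set.indicator_of_mem (by exact h)]; rfl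
          · rw [Set.indicator_of_notMem (mt hiff.1 h), Set.indicator_of_notMem (by exact h)]
        · exact hm hS
    _ = _ := by
        rw [this]
        refine lintegral_congr fun ω => ?_
        by_cases hω : hist n ω ∈ E
        · rw [Set.indicator_of_mem hω, ← lintegral_indicator_one (measurableSet_singleton _)]
          refine lintegral_congr fun a => ?_
          simp [Set.indicator, hω]
        · simp [hω]

theorem ae_zero : ∀ᵐ ω ∂(law ν A), ω 0 = (none, 0) := by
  have h2 := Kernel.traj_map_frestrictLe_apply (X := fun _ => Obs K)
    (κ := stepKernel ν A) 0 0 (fun _ => (none, 0))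
  rw [Kernel.partialTraj_self, Kernel.id_apply] at h2
  have h3 : ∀ᵐ h ∂((law ν A).map (hist 0)), h ⟨0, by simp⟩ = (none, 0) := by
    change ∀ᵐ h ∂(Measure.map (Preorder.frestrictLe 0) (law ν A)), _
    rw [law, h2, ae_dirac_iff]
    exact (measurableSet_singleton _).preimage (measurable_pi_apply _)
  exact ae_of_ae_map (measurable_hist 0).aemeasurable h3

end Law

/-! ### Recursions along a path -/

section Path

variable {K : ℕ}

theorem sum_hist {M : Type*} [AddCommMonoid M] (n : ℕ) (ω : ℕ → Obs K) (f : Obs K → M) :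
    ∑ s : Finset.Iic n, f (hist n ω s) = ∑ s ∈ range (n + 1), f (ω s) := by
  refine (Finset.sum_coe_sort (Finset.Iic n) (fun s => f (ω s))).trans ?_
  refine Finset.sum_congr ?_ fun _ _ => rfl
  ext s; simp

theorem pullCount_hist (n : ℕ) (ω : ℕ → Obs K) (i : Fin K) :
    pullCount (hist n ω) i = ∑ s ∈ range (n + 1), if (ω s).1 = some i then 1 else 0 := by
  rw [← sum_hist n ω (fun o => if o.1 = some i then 1 else 0)]
  simp [pullCount]

theorem rewardSum_hist (n : ℕ) (ω : ℕ → Obs K) (i : Fin K) :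
    rewardSum (hist n ω) i = ∑ s ∈ range (n + 1), if (ω s).1 = some i then (ω s).2 else 0 :=
  sum_hist n ω (fun o => if o.1 = some i then o.2 else 0)

theorem pullCount_hist_succ (n : ℕ) (ω : ℕ → Obs K) (i : Fin K) :
    pullCount (hist (n + 1) ω) i =
      pullCount (hist n ω) i + if (ω (n + 1)).1 = some i then 1 else 0 := by
  rw [pullCount_hist, pullCount_hist, Finset.sum_range_succ]

theorem rewardSum_hist_succ (n : ℕ) (ω : ℕ → Obs K) (i : Fin K) :
    rewardSum (hist (n + 1) ω) i =
      rewardSum (hist n ω) i + if (ω (n + 1)).1 = some i then (ω (n + 1)).2 else 0 := by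
  rw [rewardSum_hist, rewardSum_hist, Finset.sum_range_succ]

theorem pullCount_hist_zero {ω : ℕ → Obs K} (hω : ω 0 = (none, 0)) (i : Fin K) :
    pullCount (hist 0 ω) i = 0 := by
  simp [pullCount_hist, hω]

theorem rewardSum_hist_zero {ω : ℕ → Obs K} (hω : ω 0 = (none, 0)) (i : Fin K) :
    rewardSum (hist 0 ω) i = 0 := by
  simp [rewardSum_hist, hω]

theorem residual_hist_zero (c : Fin K → ℝ) (B : ℝ) {ω : ℕ → Obs K} (hω : ω 0 = (none, 0)) :
    residual c B (hist 0 ω) = B := by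
  simp [residual, pullCount_hist_zero hω]

theorem residual_hist_succ (c : Fin K → ℝ) (B : ℝ) (n : ℕ) (ω : ℕ → Obs K) :
    residual c B (hist (n + 1) ω) =
      residual c B (hist n ω) - (ω (n + 1)).1.elim 0 c := by
  have : ∑ i, (if (ω (n + 1)).1 = some i then c i else 0) = (ω (n + 1)).1.elim 0 c := by
    cases (ω (n + 1)).1 with
    | none => simp
    | some i => simp
  simp only [residual, pullCount_hist_succ, Nat.cast_add, add_mul, Finset.sum_add_distrib,
    ← this, sub_sub]
  simp

/-- The history also contains the dummy record at time 0; the hypothesis on `ω 0` ensures that it is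
not counted as a pull. -/
theorem sum_range_pull_eq (n : ℕ) {ω : ℕ → Obs K} (hω : ω 0 = (none, 0)) (i : Fin K) :
    ∑ t ∈ range n, (if (ω (t + 1)).1 = some i then 1 else 0 : ℝ≥0∞) =
      (pullCount (hist n ω) i : ℝ≥0∞) := by
  induction n with
  | zero => simp [pullCount_hist_zero hω]
  | succ n ih => rw [Finset.sum_range_succ, ih, pullCount_hist_succ]; simp

theorem numPulls_eq_iSup {ω : ℕ → Obs K} (hω : ω 0 = (none, 0)) (i : Fin K) :
    numPulls i ω = ⨆ n, (pullCount (hist n ω) i : ℝ≥0∞) := by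
  rw [numPulls, ENNReal.tsum_eq_iSup_nat]
  simp_rw [sum_range_pull_eq _ hω]

theorem measurable_numPulls (i : Fin K) : Measurable (numPulls (K := K) i) := by
  refine Measurable.tsum fun t => ?_
  exact Measurable.ite ((measurableSet_singleton (some i)).preimage
    (measurable_fst.comp (measurable_pi_apply _))) measurable_const measurable_const

end Path

/-! ### Expected rewards -/

section Reward

variable {K : ℕ} {ν : Fin K → Measure ℝ} [∀ i, IsProbabilityMeasure (ν i)]

theorem integrable_id_of_mem_Icc (hν : ∀ i, ∀ᵐ x ∂(ν i), x ∈ Set.Icc (0 : ℝ) 1) (i : Fin K) :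
    Integrable (fun x : ℝ => x) (ν i) :=
  Integrable.of_mem_Icc 0 1 aemeasurable_id (hν i)

omit [∀ i, IsProbabilityMeasure (ν i)] in
theorem mean_nonneg (hν : ∀ i, ∀ᵐ x ∂(ν i), x ∈ Set.Icc (0 : ℝ) 1) (i : Fin K) :
    0 ≤ mean ν i :=
  integral_nonneg_of_ae ((hν i).mono fun _ hx => hx.1)

theorem mean_le_one (hν : ∀ i, ∀ᵐ x ∂(ν i), x ∈ Set.Icc (0 : ℝ) 1) (i : Fin K) :
    mean ν i ≤ 1 := by
  have := integral_mono_ae (integrable_id_of_mem_Icc hν i) (integrable_const (1 : ℝ))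
    ((hν i).mono fun _ hx => hx.2)
  simpa [mean] using this

theorem lintegral_ofReal_reward (hν : ∀ i, ∀ᵐ x ∂(ν i), x ∈ Set.Icc (0 : ℝ) 1) (a : Action K) :
    ∫⁻ x, ENNReal.ofReal x ∂(rewardMeasure ν a) =
      ∑ i, ENNReal.ofReal (mean ν i) * if a = some i then 1 else 0 := by
  cases a with
  | none => simp [rewardMeasure]
  | some i =>
    simp only [rewardMeasure, Option.some.injEq, mul_ite, mul_one, mul_zero, Finset.sum_ite_eq,
      Finset.mem_univ, if_true]
    exact (ofReal_integral_eq_lintegral_ofReal (integrable_id_of_mem_Icc hν i)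
      ((hν i).mono fun _ hx => hx.1)).symm

/-- A Wald identity: given the action of a step, the expected reward is the mean of the chosen arm.
All terms are non-negative, so Tonelli permits summing over an infinite horizon without any
integrability. -/
theorem expectedReward_eq (hν : ∀ i, ∀ᵐ x ∂(ν i), x ∈ Set.Icc (0 : ℝ) 1) (A : Algorithm K) :
    expectedReward ν A =
      ∑ i, ENNReal.ofReal (mean ν i) * ∫⁻ ω, numPulls i ω ∂(law ν A) := by
  have hma : ∀ (i : Fin K) (t : ℕ), Measurable fun ω : ℕ → Obs K =>
      (if (ω (t + 1)).1 = some i then 1 else 0 : ℝ≥0∞) := fun i t =>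
    Measurable.ite ((measurableSet_singleton (some i)).preimage
      (measurable_fst.comp (measurable_pi_apply _))) measurable_const measurable_const
  have hstep : ∀ t : ℕ, ∫⁻ ω, ENNReal.ofReal (ω (t + 1)).2 ∂(law ν A) =
      ∑ i, ENNReal.ofReal (mean ν i) *
        ∫⁻ ω, (if (ω (t + 1)).1 = some i then 1 else 0) ∂(law ν A) := by
    intro t
    have h1 := lintegral_step ν A t (f := fun p => ENNReal.ofReal p.2.2)
      (ENNReal.measurable_ofReal.comp (measurable_snd.comp measurable_snd))
    have h2 := lintegral_step_action ν A t
      (f := fun p => ∑ i, ENNReal.ofReal (mean ν i) * if p.2 = some i then 1 else 0)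
      ((measurable_of_countable (fun a : Action K =>
        ∑ i, ENNReal.ofReal (mean ν i) * if a = some i then 1 else 0)).comp measurable_snd)
    simp only at h1 h2
    rw [h1]
    simp_rw [lintegral_ofReal_reward hν]
    rw [← h2, lintegral_finsetSum _ fun i _ => (hma i t).const_mul _]
    exact Finset.sum_congr rfl fun i _ => lintegral_const_mul _ (hma i t)
  simp only [expectedReward, totalReward, numPulls]
  have hmr : ∀ t : ℕ, Measurable fun ω : ℕ → Obs K => ENNReal.ofReal (ω (t + 1)).2 := fun t =>
    (measurable_snd.comp (measurable_pi_apply (t + 1))).ennreal_ofReal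
  rw [lintegral_tsum fun t => (hmr t).aemeasurable]
  simp_rw [hstep]
  rw [Summable.tsum_finsetSum fun _ _ => ENNReal.summable]
  refine Finset.sum_congr rfl fun i _ => ?_
  rw [ENNReal.tsum_mul_left, lintegral_tsum fun t => (hma i t).aemeasurable]

theorem sum_lintegral_numPulls_le {c : Fin K → ℝ} {B : ℝ} {A : Algorithm K}
    (hA : RespectsBudget c ν B A) :
    ∑ i, (∫⁻ ω, numPulls i ω ∂(law ν A)) * ENNReal.ofReal (c i) ≤ ENNReal.ofReal B := by
  calc _ = ∫⁻ ω, ∑ i, numPulls i ω * ENNReal.ofReal (c i) ∂(law ν A) := by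
        rw [lintegral_finsetSum _ fun i _ => (measurable_numPulls i).mul_const _]
        exact Finset.sum_congr rfl fun i _ => (lintegral_mul_const _ (measurable_numPulls i)).symm
    _ ≤ ∫⁻ _, ENNReal.ofReal B ∂(law ν A) := lintegral_mono_ae hA
    _ = _ := by simp

/-- The fractional relaxation of the knapsack: each unit of budget earns at most the best density.
-/
theorem expectedReward_le_of_respectsBudget {c : Fin K → ℝ} (hc : ∀ i, 0 < c i)
    (hν : ∀ i, ∀ᵐ x ∂(ν i), x ∈ Set.Icc (0 : ℝ) 1) {I : Fin K}
    (hI : ∀ j, mean ν j / c j ≤ mean ν I / c I) {B : ℝ} {A : Algorithm K}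
    (hA : RespectsBudget c ν B A) :
    expectedReward ν A ≤ ENNReal.ofReal (mean ν I / c I * B) := by
  have hd : 0 ≤ mean ν I / c I := div_nonneg (mean_nonneg hν I) (hc I).le
  rw [expectedReward_eq hν, ENNReal.ofReal_mul hd]
  refine le_trans ?_ (mul_le_mul_right (sum_lintegral_numPulls_le hA) _)
  rw [Finset.mul_sum]
  refine Finset.sum_le_sum fun i _ => ?_
  rw [mul_comm (lintegral _ _), ← mul_assoc, ← ENNReal.ofReal_mul hd]
  gcongr
  exact (div_le_iff₀ (hc i)).1 (hI i)

theorem optimalReward_le {c : Fin K → ℝ} (hc : ∀ i, 0 < c i)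
    (hν : ∀ i, ∀ᵐ x ∂(ν i), x ∈ Set.Icc (0 : ℝ) 1) {I : Fin K}
    (hI : ∀ j, mean ν j / c j ≤ mean ν I / c I) (B : ℝ) :
    optimalReward c ν B ≤ ENNReal.ofReal (mean ν I / c I * B) :=
  iSup₂_le fun _ hA => expectedReward_le_of_respectsBudget hc hν hI hA

theorem lintegral_numPulls_ne_top {c : Fin K → ℝ} (hc : ∀ i, 0 < c i) {B : ℝ} {A : Algorithm K}
    (hA : RespectsBudget c ν B A) (i : Fin K) : ∫⁻ ω, numPulls i ω ∂(law ν A) ≠ ∞ := by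
  intro h
  have h1 := (Finset.single_le_sum (f := fun i => (∫⁻ ω, numPulls i ω ∂(law ν A)) *
    ENNReal.ofReal (c i)) (fun _ _ => zero_le) (Finset.mem_univ i)).trans
    (sum_lintegral_numPulls_le hA)
  simp only [h] at h1
  rw [ENNReal.top_mul (by simpa using hc i)] at h1
  exact ENNReal.ofReal_ne_top (top_le_iff.1 h1)

end Reward

/-! ### Concentration of the rewards of an arm -/

section Concentration

variable {K : ℕ} {ν : Fin K → Measure ℝ} [∀ i, IsProbabilityMeasure (ν i)]

/-- The exponential weight `exp (s (S - μ n) - n s² / 8)` of a history, where `S` is the sum of the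
`n` rewards of arm `i` and `μ` is their mean. -/
noncomputable def expWeight (ν : Fin K → Measure ℝ) (i : Fin K) (s : ℝ) {n : ℕ}
    (h : History K n) : ℝ :=
  Real.exp (s * (rewardSum h i - mean ν i * pullCount h i) - pullCount h i * (s ^ 2 / 8))

omit [∀ i, IsProbabilityMeasure (ν i)] in
theorem measurable_expWeight (i : Fin K) (s : ℝ) (n : ℕ) :
    Measurable (fun h : History K n => expWeight ν i s h) :=
  ((((measurable_rewardSum i).sub ((measurable_cast_pullCount i).const_mul _)).const_mul s).sub
    ((measurable_cast_pullCount i).mul_const _)).exp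

omit [∀ i, IsProbabilityMeasure (ν i)] in
theorem expWeight_hist_succ (i : Fin K) (s : ℝ) (n : ℕ) (ω : ℕ → Obs K) :
    expWeight ν i s (hist (n + 1) ω) = expWeight ν i s (hist n ω) *
      if (ω (n + 1)).1 = some i then Real.exp (s * ((ω (n + 1)).2 - mean ν i) - s ^ 2 / 8)
      else 1 := by
  simp only [expWeight, rewardSum_hist_succ, pullCount_hist_succ]
  split_ifs
  · rw [← Real.exp_add]; push_cast; ring_nf
  · simp

/-- Hoeffding's lemma: a variable in an interval of length 1 is sub-Gaussian with variance proxy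
1/4. -/
theorem lintegral_exp_reward_le_one (hν : ∀ i, ∀ᵐ x ∂(ν i), x ∈ Set.Icc (0 : ℝ) 1) (i : Fin K)
    (s : ℝ) : ∫⁻ x, ENNReal.ofReal (Real.exp (s * (x - mean ν i) - s ^ 2 / 8)) ∂(ν i) ≤ 1 := by
  have h := hasSubgaussianMGF_of_mem_Icc (X := fun x : ℝ => x) aemeasurable_id (hν i)
  have hint := h.integrable_exp_mul s
  have hle := h.mgf_le s
  change Integrable (fun x => Real.exp (s * (x - mean ν i))) (ν i) at hint
  change ∫ x, Real.exp (s * (x - mean ν i)) ∂(ν i) ≤ _ at hle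
  simp_rw [Real.exp_sub, div_eq_mul_inv (Real.exp _)]
  rw [← ofReal_integral_eq_lintegral_ofReal (hint.mul_const _)
    (Filter.Eventually.of_forall fun x => by positivity), integral_mul_const]
  rw [ENNReal.ofReal_le_one, ← div_eq_mul_inv, div_le_one (Real.exp_pos _)]
  refine hle.trans (Real.exp_le_exp.2 (le_of_eq ?_))
  norm_num
  ring

/-- The weight is a supermartingale: a pull of arm `i` multiplies it by a factor of conditional mean
at most 1, any other action leaves it unchanged. Hence adaptive sampling does no harm. -/
theorem lintegral_expWeight_le_one (hν : ∀ i, ∀ᵐ x ∂(ν i), x ∈ Set.Icc (0 : ℝ) 1)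
    (A : Algorithm K) (i : Fin K) (s : ℝ) (n : ℕ) :
    ∫⁻ ω, ENNReal.ofReal (expWeight ν i s (hist n ω)) ∂(law ν A) ≤ 1 := by
  induction n with
  | zero =>
    have : ∀ᵐ ω ∂(law ν A), ENNReal.ofReal (expWeight ν i s (hist 0 ω)) = 1 := by
      filter_upwards [ae_zero ν A] with ω hω
      simp [expWeight, pullCount_hist_zero hω, rewardSum_hist_zero hω]
    rw [lintegral_congr_ae this]
    simp
  | succ n ih =>
    let g : Obs K → ℝ := fun o => if o.1 = some i then
      Real.exp (s * (o.2 - mean ν i) - s ^ 2 / 8) else 1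
    have hg : Measurable g := Measurable.ite ((measurableSet_singleton (some i)).preimage
      measurable_fst) (((measurable_snd.sub_const _).const_mul s).sub_const _).exp measurable_const
    have hw := measurable_expWeight (ν := ν) i s n
    have h1 := lintegral_step ν A n
      (f := fun p => ENNReal.ofReal (expWeight ν i s p.1) * ENNReal.ofReal (g p.2))
      ((hw.comp measurable_fst).ennreal_ofReal.mul (hg.comp measurable_snd).ennreal_ofReal)
    have h2 : ∀ ω : ℕ → Obs K, ENNReal.ofReal (expWeight ν i s (hist (n + 1) ω)) =
        ENNReal.ofReal (expWeight ν i s (hist n ω)) * ENNReal.ofReal (g (ω (n + 1))) := by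
      intro ω
      rw [expWeight_hist_succ, ENNReal.ofReal_mul (by unfold expWeight; positivity)]
    simp_rw [h2]
    rw [h1]
    refine le_trans (lintegral_mono fun ω => ?_) ih
    have h3 : ∀ a, ∫⁻ x, ENNReal.ofReal (g (a, x)) ∂(rewardMeasure ν a) ≤ 1 := by
      intro a
      by_cases ha : a = some i
      · subst ha
        simpa [g, rewardMeasure] using lintegral_exp_reward_le_one hν i s
      · have : IsProbabilityMeasure (rewardMeasure ν a) :=
          (inferInstance : IsMarkovKernel (rewardKernel ν)).isProbabilityMeasure a
        simp [g, ha]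
    calc _ = ∫⁻ a, ENNReal.ofReal (expWeight ν i s (hist n ω)) *
          ∫⁻ x, ENNReal.ofReal (g (a, x)) ∂(rewardMeasure ν a) ∂(A.choose n (hist n ω)) :=
          lintegral_congr fun a => lintegral_const_mul _
            (hg.comp measurable_prodMk_left).ennreal_ofReal
      _ ≤ ∫⁻ _, ENNReal.ofReal (expWeight ν i s (hist n ω)) ∂(A.choose n (hist n ω)) :=
          lintegral_mono fun a => mul_le_of_le_one_right zero_le (h3 a)
      _ = _ := by simp

theorem law_expWeight_ge_le (hν : ∀ i, ∀ᵐ x ∂(ν i), x ∈ Set.Icc (0 : ℝ) 1)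
    (A : Algorithm K) (i : Fin K) (s : ℝ) (n : ℕ) (x : ℝ) :
    law ν A {ω | Real.exp x ≤ expWeight ν i s (hist n ω)} ≤ ENNReal.ofReal (Real.exp (-x)) := by
  have hm : Measurable fun ω : ℕ → Obs K => ENNReal.ofReal (expWeight ν i s (hist n ω)) :=
    ((measurable_expWeight i s n).comp (measurable_hist n)).ennreal_ofReal
  have h := meas_ge_le_lintegral_div (μ := law ν A) hm.aemeasurable
    (ε := ENNReal.ofReal (Real.exp x)) (by simpa using Real.exp_pos x) ENNReal.ofReal_ne_top
  refine le_trans (measure_mono fun ω hω => ENNReal.ofReal_le_ofReal hω) (h.trans ?_)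
  rw [Real.exp_neg, ENNReal.ofReal_inv_of_pos (Real.exp_pos x), ENNReal.div_eq_inv_mul]
  exact mul_le_of_le_one_right zero_le (lintegral_expWeight_le_one hν A i s n)

theorem pullCount_hist_le {ω : ℕ → Obs K} (hω : ω 0 = (none, 0)) (n : ℕ) (i : Fin K) :
    pullCount (hist n ω) i ≤ n := by
  induction n with
  | zero => simp [pullCount_hist_zero hω]
  | succ n ih => rw [pullCount_hist_succ]; split_ifs <;> omega

/-- The deviation of the average reward of an arm from its mean, to either side (`r = 1` or
`r = -1`), is at least the confidence radius with small probability only. -/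
theorem law_deviation_le (hν : ∀ i, ∀ᵐ x ∂(ν i), x ∈ Set.Icc (0 : ℝ) 1)
    (A : Algorithm K) (i : Fin K) {r : ℝ} (hr : r ^ 2 = 1) (n : ℕ) :
    law ν A {ω | 1 ≤ pullCount (hist n ω) i ∧
      √(2 * pullCount (hist n ω) i * Real.log ((n : ℝ) + 1)) ≤
        r * (rewardSum (hist n ω) i - mean ν i * pullCount (hist n ω) i)} ≤
      ENNReal.ofReal (1 / ((n : ℝ) + 1) ^ 2) := by
  set L := Real.log ((n : ℝ) + 1) with hL
  have hn1 : (0 : ℝ) < (n : ℝ) + 1 := by positivity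
  have hL0 : 0 ≤ L := Real.log_nonneg (by simp)
  -- The exponent optimal for a deviation of √(2kL) after exactly k pulls: the linear term is at
  -- least 8L and the quadratic penalty is 4L. It depends on k, hence the union over all possible
  -- pull counts.
  let lam : ℕ → ℝ := fun k => r * (4 * √(2 * k * L) / k)
  have hsub : {ω | 1 ≤ pullCount (hist n ω) i ∧
      √(2 * pullCount (hist n ω) i * L) ≤
        r * (rewardSum (hist n ω) i - mean ν i * pullCount (hist n ω) i)} ≤ᵐ[law ν A]
      ⋃ k ∈ Finset.Icc 1 n, {ω | Real.exp (4 * L) ≤ expWeight ν i (lam k) (hist n ω)} := by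
    filter_upwards [ae_zero ν A] with ω hω h
    obtain ⟨h1, h2⟩ := h
    refine Set.mem_iUnion₂.2 ⟨pullCount (hist n ω) i,
      Finset.mem_Icc.2 ⟨h1, pullCount_hist_le hω n i⟩, ?_⟩
    refine Real.exp_le_exp.2 ?_
    set k := pullCount (hist n ω) i with hk
    have hk0 : (0 : ℝ) < k := by exact_mod_cast h1
    set D := rewardSum (hist n ω) i - mean ν i * k
    set e := √(2 * k * L) with he
    have he0 : 0 ≤ e := Real.sqrt_nonneg _
    have he2 : e ^ 2 = 2 * k * L := Real.sq_sqrt (by positivity)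
    have h3 : lam k * D = 4 * e / k * (r * D) := by simp only [lam, ← he]; ring
    have h4 : (lam k) ^ 2 = 32 * L / k := by
      simp only [lam, ← he]
      rw [mul_pow, hr, div_pow, mul_pow, he2]
      field_simp
      ring
    rw [h3, h4]
    have h5 : 4 * e / k * e ≤ 4 * e / k * (r * D) := by gcongr
    have h6 : 4 * e / k * e = 8 * L := by
      rw [div_mul_eq_mul_div, mul_assoc, ← sq, he2]; field_simp; ring
    have h7 : (k : ℝ) * (32 * L / k / 8) = 4 * L := by field_simp; ring
    linarith
  calc _ ≤ law ν A (⋃ k ∈ Finset.Icc 1 n,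
        {ω | Real.exp (4 * L) ≤ expWeight ν i (lam k) (hist n ω)}) := measure_mono_ae hsub
    _ ≤ ∑ k ∈ Finset.Icc 1 n,
        law ν A {ω | Real.exp (4 * L) ≤ expWeight ν i (lam k) (hist n ω)} :=
        measure_biUnion_finset_le _ _
    _ ≤ ∑ k ∈ Finset.Icc 1 n, ENNReal.ofReal (Real.exp (-(4 * L))) :=
        Finset.sum_le_sum fun k _ => law_expWeight_ge_le hν A i _ n _
    _ = ENNReal.ofReal (n * Real.exp (-(4 * L))) := by
        rw [ENNReal.ofReal_mul (by positivity)]; simp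
    -- Each of the n terms is (n + 1)^(-4), and n ≤ (n + 1)².
    _ ≤ _ := by
        refine ENNReal.ofReal_le_ofReal ?_
        have : Real.exp (-(4 * L)) = 1 / ((n : ℝ) + 1) ^ 4 := by
          rw [Real.exp_neg, one_div, hL, ← Real.exp_log hn1, ← Real.exp_nat_mul,
            Real.exp_log hn1]
          norm_num
        rw [this, mul_one_div, div_le_div_iff₀ (by positivity) (by positivity)]
        have : (0 : ℝ) ≤ n := by positivity
        nlinarith [mul_nonneg (pow_pos hn1 2).le this,
          mul_nonneg (pow_pos hn1 2).le (mul_nonneg this this)]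

end Concentration

/-! ### Greedy solutions of the knapsack problem -/

section Greedy

variable {K : ℕ}

theorem costMin_le (c : Fin K → ℝ) (i : Fin K) : costMin c ≤ c i :=
  ciInf_le (Set.finite_range c).bddBelow i

theorem le_costMax (c : Fin K → ℝ) (i : Fin K) : c i ≤ costMax c :=
  le_ciSup (Set.finite_range c).bddAbove i

theorem costMin_pos [Nonempty (Fin K)] {c : Fin K → ℝ} (hc : ∀ i, 0 < c i) : 0 < costMin c := by
  obtain ⟨i, hi⟩ := exists_costMin_eq c
  exact hi ▸ hc i

theorem costMin_le_costMax [Nonempty (Fin K)] (c : Fin K → ℝ) : costMin c ≤ costMax c :=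
  (costMin_le c (Classical.arbitrary _)).trans (le_costMax c _)

variable {c v : Fin K → ℝ} {C : ℝ} {m : Fin K → ℕ}

theorem IsGreedySolution.cost_le (hc : ∀ i, 0 < c i) (hm : IsGreedySolution c v C m) {i : Fin K}
    (hi : m i ≠ 0) : c i ≤ C := by
  obtain ⟨σ, -, h⟩ := hm
  have h1 := h (σ.symm i)
  rw [Equiv.apply_symm_apply] at h1
  have h2 : 1 ≤ m i := Nat.one_le_iff_ne_zero.2 hi
  rw [h1, Nat.one_le_floor_iff, le_div_iff₀ (hc i), one_mul] at h2
  refine h2.trans (sub_le_self _ (Finset.sum_nonneg fun l _ => ?_))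
  exact mul_nonneg (Nat.cast_nonneg _) (hc _).le

/-- An arm of non-maximal density makes up a small part of a greedy solution only. -/
theorem IsGreedySolution.div_sum_le [Nonempty (Fin K)] (hc : ∀ i, 0 < c i) (hC : 0 < C)
    (hm : IsGreedySolution c v C m) {i j : Fin K} (hij : v j / c j < v i / c i) :
    (m j : ℝ) / ∑ k, (m k : ℝ) ≤ costMax c ^ 2 / (costMin c * C) := by
  have hcm := costMin_pos hc
  rcases Nat.eq_zero_or_pos (m j) with h0 | hpos
  · rw [h0]; simp; positivity
  obtain ⟨σ, hσ, h⟩ := hm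
  have hK : 0 < K := j.pos
  let z : Fin K := ⟨0, hK⟩
  set a := σ z with ha
  -- The first arm in the greedy order has maximal density, and `j` does not.
  have hja : j ≠ a := by
    rintro rfl
    have := hσ (show z ≤ σ.symm i from Nat.zero_le _)
    simp only [Equiv.apply_symm_apply] at this
    exact absurd hij (not_lt.2 this)
  have hza : m a = ⌊C / c a⌋₊ := by
    have := h z
    have hf : (Finset.univ.filter (· < z)) = ∅ := by
      ext l; simp [z, Fin.lt_def]
    simpa [hf] using this
  have hz : z < σ.symm j := by
    refine Fin.lt_def.2 (Nat.pos_of_ne_zero fun h0 => hja ?_)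
    rw [ha, ← Equiv.symm_apply_eq]
    exact Fin.ext h0
  have hx : (m j : ℝ) * c j ≤ C - m a * c a := by
    have h1 := h (σ.symm j)
    rw [Equiv.apply_symm_apply] at h1
    set S := ∑ l ∈ Finset.univ.filter (· < σ.symm j), (m (σ l) : ℝ) * c (σ l) with hS
    have hSa : (m a : ℝ) * c a ≤ S :=
      Finset.single_le_sum (f := fun l => (m (σ l) : ℝ) * c (σ l))
        (fun l _ => mul_nonneg (Nat.cast_nonneg _) (hc _).le) (by simpa using hz)
    have h2 : (1 : ℕ) ≤ ⌊(C - S) / c j⌋₊ := h1 ▸ hpos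
    rw [Nat.one_le_floor_iff] at h2
    have h3 : (m j : ℝ) ≤ (C - S) / c j := h1 ▸ Nat.floor_le (by linarith)
    rw [le_div_iff₀ (hc j)] at h3
    linarith
  have hlt : C < (m a + 1) * c a := by
    rw [hza, ← div_lt_iff₀ (hc a)]
    exact Nat.lt_floor_add_one _
  have hx1 : (1 : ℝ) ≤ m j := by exact_mod_cast hpos
  have hsum : (m j : ℝ) + m a ≤ ∑ k, (m k : ℝ) := by
    rw [← Finset.sum_pair hja (f := fun k => (m k : ℝ))]
    exact Finset.sum_le_sum_of_subset_of_nonneg (Finset.subset_univ _) fun _ _ _ =>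
      Nat.cast_nonneg _
  -- Since m j ≥ 1, it can replace the 1 in C < (m a + 1) c a.
  have hC1 : C ≤ c a * (m j + m a) := by nlinarith [hc a]
  have hma := Nat.cast_nonneg (α := ℝ) (m a)
  rw [div_le_div_iff₀ (by linarith) (by positivity)]
  -- Arm `j` is bought from what the first arm leaves over, which is less than c a.
  have hcj : (m j : ℝ) * costMin c ≤ costMax c := by
    calc (m j : ℝ) * costMin c ≤ m j * c j := by gcongr; exact costMin_le c j
      _ ≤ c a := by linarith
      _ ≤ costMax c := le_costMax c a
  have hM : 0 < costMax c := hcm.trans_le (costMin_le_costMax c)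
  calc (m j : ℝ) * (costMin c * C) = (m j * costMin c) * C := by ring
    _ ≤ costMax c * (c a * (m j + m a)) := by gcongr
    _ ≤ costMax c * (costMax c * ∑ k, (m k : ℝ)) := by
        gcongr
        exact le_costMax c a
    _ = _ := by ring

end Greedy

/-! ### The actions of KUBE -/

section Choose

variable {K : ℕ} {c : Fin K → ℝ} {B : ℝ} {A : Algorithm K}

theorem IsKUBE.ae_cost_le (hc : ∀ i, 0 < c i) (hA : IsKUBE c B A) (n : ℕ) (h : History K n) :
    ∀ᵐ a ∂(A.choose n h), ∀ i, a = some i → c i ≤ residual c B h := by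
  obtain ⟨h1, h2, h3⟩ := hA n h
  rcases lt_or_ge (residual c B h) (costMin c) with hr | hr
  · rw [h1 hr, ae_dirac_iff (.of_discrete)]
    simp
  · rcases lt_or_ge n K with hn | hn
    · rw [h2 hr ⟨n, hn⟩ rfl, ae_dirac_iff (.of_discrete)]
      split_ifs with hle
      · rintro i hi
        rw [← Option.some.inj hi]; exact hle
      · simp
    · obtain ⟨m, hm, hp⟩ := h3 hr hn
      rw [ae_iff_of_countable]
      rintro a ha i rfl
      refine hm.cost_le hc fun h0 => ha ?_
      simp [hp, h0]

theorem IsKUBE.ae_initial (hA : IsKUBE c B A) (i : Fin K) (h : History K i) :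
    ∀ᵐ a ∂(A.choose i h), (c i ≤ residual c B h → a = some i) ∧ ∀ j, a = some j → j = i := by
  obtain ⟨h1, h2, -⟩ := hA i h
  rcases lt_or_ge (residual c B h) (costMin c) with hr | hr
  · rw [h1 hr, ae_dirac_iff (.of_discrete)]
    exact ⟨fun hle => absurd (hle.trans_lt hr) (costMin_le c i).not_gt, by simp⟩
  · rw [h2 hr i rfl, ae_dirac_iff (.of_discrete)]
    split_ifs with hle
    · exact ⟨fun _ => rfl, fun j hj => (Option.some.inj hj).symm⟩
    · exact ⟨fun h => absurd h hle, by simp⟩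

/-- The cheapest arm fits, so the greedy solution is non-zero and the prescribed arm probabilities
already add up to 1; no mass is left for `none`. -/
theorem IsKUBE.ae_ne_none [Nonempty (Fin K)] (hc : ∀ i, 0 < c i) (hA : IsKUBE c B A) {n : ℕ}
    (hn : K ≤ n) (h : History K n) :
    ∀ᵐ a ∂(A.choose n h), costMin c ≤ residual c B h → a ≠ none := by
  rcases lt_or_ge (residual c B h) (costMin c) with hr | hr
  · exact Filter.Eventually.of_forall fun _ hr' => absurd hr hr'.not_gt
  obtain ⟨m, hm, hp⟩ := (hA n h).2.2 hr hn
  obtain ⟨i₀, hi₀⟩ := exists_costMin_eq c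
  have hpos := greedy_pos c _ hc _ m hm i₀ (hi₀ ▸ hr)
  have hpos' : (∑ k, (m k : ℝ)) ≠ 0 := by exact_mod_cast hpos.ne'
  rw [ae_iff_of_countable]
  rintro a ha - rfl
  apply ha
  have h1 : ∑ a : Action K, A.choose n h {a} = 1 := by simp
  rw [Fintype.sum_option] at h1
  have h2 : ∑ i, A.choose n h {some i} = 1 := by
    simp_rw [hp]
    rw [← ENNReal.ofReal_sum_of_nonneg (fun _ _ => by positivity), ← Finset.sum_div,
      div_self hpos', ENNReal.ofReal_one]
  rw [h2] at h1
  exact (ENNReal.add_left_inj ENNReal.one_ne_top).1 (h1.trans (zero_add 1).symm)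

/-- Bound on the probability that KUBE pulls an arm of non-maximal estimated density. -/
noncomputable def exploitBound (c : Fin K → ℝ) (r : ℝ) : ℝ :=
  if r < costMin c then 0 else min 1 ((costMax c / costMin c) ^ 2 / (r / costMin c))

theorem IsKUBE.choose_le [Nonempty (Fin K)] (hc : ∀ i, 0 < c i) (hA : IsKUBE c B A) {n : ℕ}
    (hn : K ≤ n) (h : History K n) {j : Fin K}
    (hj : residual c B h < costMax c ∨ ∃ i, ucb h j / c j < ucb h i / c i) :
    A.choose n h {some j} ≤ ENNReal.ofReal (exploitBound c (residual c B h)) := by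
  have hcm := costMin_pos hc
  rw [exploitBound]
  split_ifs with hr
  · rw [(hA n h).1 hr]
    simp
  push Not at hr
  have hr0 : 0 < residual c B h := hcm.trans_le hr
  have hcM : 0 < costMax c := hcm.trans_le (costMin_le_costMax c)
  rw [ENNReal.ofReal_min, ENNReal.ofReal_one]
  refine le_min prob_le_one ?_
  have heq : (costMax c / costMin c) ^ 2 / (residual c B h / costMin c) =
      costMax c ^ 2 / (costMin c * residual c B h) := by field_simp
  rw [heq]
  rcases hj with hj | ⟨i, hi⟩
  -- With residual budget below c_max the asserted bound is at least 1, so it holds trivially.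
  · refine le_trans prob_le_one ?_
    rw [ENNReal.one_le_ofReal, le_div_iff₀ (by positivity), one_mul, sq]
    have := costMin_le_costMax c
    gcongr
  · obtain ⟨m, hm, hp⟩ := (hA n h).2.2 hr hn
    rw [hp]
    exact ENNReal.ofReal_le_ofReal (hm.div_sum_le hc hr0 hi)

end Choose

/-! ### The paths of KUBE -/

/-- Properties that hold for almost every sequence of records produced by KUBE. -/
structure IsKubePath {K : ℕ} (c : Fin K → ℝ) (B : ℝ) (ω : ℕ → Obs K) : Prop where
  zero : ω 0 = (none, 0)
  cost_le : ∀ n i, (ω (n + 1)).1 = some i → c i ≤ residual c B (hist n ω)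
  initial : ∀ i : Fin K, c i ≤ residual c B (hist i ω) → (ω (i + 1)).1 = some i
  initial_eq : ∀ i j : Fin K, (ω (i + 1)).1 = some j → j = i
  late : ∀ n, K ≤ n → costMin c ≤ residual c B (hist n ω) → (ω (n + 1)).1 ≠ none

theorem IsKUBE.ae_isKubePath {K : ℕ} [Nonempty (Fin K)] {c : Fin K → ℝ} {B : ℝ}
    {A : Algorithm K} (hc : ∀ i, 0 < c i) (hA : IsKUBE c B A) (ν : Fin K → Measure ℝ)
    [∀ i, IsProbabilityMeasure (ν i)] : ∀ᵐ ω ∂(law ν A), IsKubePath c B ω := by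
  have hle : ∀ (n : ℕ) (x : ℝ), MeasurableSet {h : History K n | x ≤ residual c B h} :=
    fun n x => measurableSet_le measurable_const (measurable_residual c B)
  have h1 : ∀ᵐ ω ∂(law ν A), ∀ n, ∀ i, (ω (n + 1)).1 = some i →
      c i ≤ residual c B (hist n ω) := by
    rw [ae_all_iff]
    intro n
    refine ae_step_action ν A n (P := fun h a => ∀ i, a = some i → c i ≤ residual c B h)
      (fun a => ?_) (hA.ae_cost_le hc n)
    exact measurableSet_setOfPred.2 (Measurable.forall fun i => Measurable.forall fun _ =>
      measurableSet_setOfPred.1 (hle n _))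
  have h2 : ∀ᵐ ω ∂(law ν A), ∀ i : Fin K,
      (c i ≤ residual c B (hist i ω) → (ω (i + 1)).1 = some i) ∧
        ∀ j, (ω (i + 1)).1 = some j → j = i := by
    rw [ae_all_iff]
    intro i
    refine ae_step_action ν A i
      (P := fun h a => (c i ≤ residual c B h → a = some i) ∧ ∀ j, a = some j → j = i)
      (fun a => ?_) (hA.ae_initial i)
    exact measurableSet_setOfPred.2 (((measurableSet_setOfPred.1 (hle i _)).imp
      measurable_const).and measurable_const)
  have h3 : ∀ᵐ ω ∂(law ν A), ∀ n, K ≤ n → costMin c ≤ residual c B (hist n ω) →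
      (ω (n + 1)).1 ≠ none := by
    rw [ae_all_iff]
    intro n
    by_cases hn : K ≤ n
    · have := ae_step_action ν A n
        (P := fun h a => costMin c ≤ residual c B h → a ≠ none)
        (fun a => measurableSet_setOfPred.2 ((measurableSet_setOfPred.1 (hle n _)).imp
          measurable_const)) (hA.ae_ne_none hc hn)
      filter_upwards [this] with ω hω _ using hω
    · exact Filter.Eventually.of_forall fun _ h => absurd h hn
  filter_upwards [ae_zero ν A, h1, h2, h3] with ω h0 h1 h2 h3
  exact ⟨h0, h1, fun i => (h2 i).1, fun i => (h2 i).2, h3⟩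

/-- Potential that dominates the sum of the probabilities `exploitBound` along a path. -/
noncomputable def exploitPotential {K : ℕ} (c : Fin K → ℝ) (r : ℝ) : ℝ :=
  if r < costMin c then 0
  else 1 + (costMax c / costMin c) ^ 2 * Real.log (r / costMin c)

/-! ### The logarithmic potential for the residual budget. -/

section Potential

variable {K : ℕ} [Nonempty (Fin K)] {c : Fin K → ℝ}

theorem one_le_costMax_div_costMin (hc : ∀ i, 0 < c i) : 1 ≤ (costMax c / costMin c) ^ 2 :=
  one_le_pow₀ ((one_le_div (costMin_pos hc)).2 (costMin_le_costMax c))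

theorem exploitBound_nonneg (hc : ∀ i, 0 < c i) (r : ℝ) : 0 ≤ exploitBound c r := by
  have := costMin_pos hc
  rw [exploitBound]
  split_ifs with h
  · exact le_rfl
  · push Not at h
    have : 0 < r := this.trans_le h
    positivity

theorem exploitPotential_nonneg (hc : ∀ i, 0 < c i) (r : ℝ) : 0 ≤ exploitPotential c r := by
  rw [exploitPotential]
  split_ifs with h
  · exact le_rfl
  · have : 0 ≤ Real.log (r / costMin c) :=
      Real.log_nonneg ((one_le_div (costMin_pos hc)).2 (not_lt.1 h))
    positivity

theorem exploitPotential_mono (hc : ∀ i, 0 < c i) : Monotone (exploitPotential c) := by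
  intro r r' hr
  have hcm := costMin_pos hc
  by_cases h : r < costMin c
  · simpa [exploitPotential, h] using exploitPotential_nonneg hc r'
  · have h' : ¬ r' < costMin c := fun h2 => h (hr.trans_lt h2)
    simp only [exploitPotential, h, h', if_false]
    push Not at h
    have := hcm.trans_le h
    gcongr

/-- With v = r/c_min this is 1/v ≤ ln v - ln (v - 1). For the last affordable pull the logarithm is
unavailable, and the jump of 1 in the potential pays for the probability, which is at most 1. -/
theorem exploitBound_add_exploitPotential_le (hc : ∀ i, 0 < c i) {r r' : ℝ}
    (hr : costMin c ≤ r) (hr' : r' ≤ r - costMin c) :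
    exploitBound c r + exploitPotential c r' ≤ exploitPotential c r := by
  have hcm := costMin_pos hc
  have hp := one_le_costMax_div_costMin hc
  set p := (costMax c / costMin c) ^ 2
  have hv : 1 ≤ r / costMin c := (one_le_div hcm).2 hr
  simp only [exploitBound, exploitPotential, hr.not_gt, if_false]
  split_ifs with h
  · have := mul_nonneg (zero_le_one.trans hp) (Real.log_nonneg hv)
    have := min_le_left 1 (p / (r / costMin c))
    linarith
  · push Not at h
    have hv1 : 1 ≤ r' / costMin c := (one_le_div hcm).2 h
    have hv2 : r' / costMin c ≤ r / costMin c - 1 := by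
      rw [div_sub_one hcm.ne']; gcongr
    set v := r / costMin c
    set v' := r' / costMin c
    have hlog : 1 / v ≤ Real.log v - Real.log v' := by
      rw [← Real.log_div (by linarith) (by linarith)]
      have h1 := Real.one_sub_inv_le_log_of_pos (x := v / v') (by positivity)
      refine le_trans ?_ h1
      rw [inv_div, le_sub_iff_add_le, ← add_div, div_le_one (by linarith)]
      linarith
    have h2 := mul_le_mul_of_nonneg_left hlog (zero_le_one.trans hp)
    rw [mul_one_div] at h2
    have := min_le_right 1 (p / v)
    linarith

end Potential

/-! ### Budget consumption and pull counts along a path of KUBE. -/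

namespace IsKubePath

variable {K : ℕ} [Nonempty (Fin K)] {c : Fin K → ℝ} {B : ℝ} {ω : ℕ → Obs K}

omit [Nonempty (Fin K)] in
theorem residual_nonneg (hω : IsKubePath c B ω) (hB : 0 ≤ B) (n : ℕ) :
    0 ≤ residual c B (hist n ω) := by
  induction n with
  | zero => rwa [residual_hist_zero c B hω.zero]
  | succ n ih =>
    rw [residual_hist_succ]
    cases h : (ω (n + 1)).1 with
    | none => simpa using ih
    | some i => simpa using hω.cost_le n i h

omit [Nonempty (Fin K)] in
theorem _root_.BudgetBandit.residual_hist_antitone (hc : ∀ i, 0 < c i) (B : ℝ)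
    (ω : ℕ → Obs K) : Antitone fun n => residual c B (hist n ω) := by
  refine antitone_nat_of_succ_le fun n => ?_
  rw [residual_hist_succ]
  cases (ω (n + 1)).1 with
  | none => simp
  | some i => simpa using (hc i).le

omit [Nonempty (Fin K)] in
theorem residual_succ_of_lt (hω : IsKubePath c B ω) {n : ℕ}
    (hr : residual c B (hist n ω) < costMin c) :
    residual c B (hist (n + 1) ω) = residual c B (hist n ω) := by
  rw [residual_hist_succ]
  cases h : (ω (n + 1)).1 with
  | none => simp
  | some i => exact absurd (hr.trans_le (costMin_le c i)) (hω.cost_le n i h).not_gt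

omit [Nonempty (Fin K)] in
theorem residual_succ_of_late (hω : IsKubePath c B ω) {n : ℕ} (hn : K ≤ n)
    (hr : costMin c ≤ residual c B (hist n ω)) :
    residual c B (hist (n + 1) ω) ≤ residual c B (hist n ω) - costMin c := by
  rw [residual_hist_succ]
  cases h : (ω (n + 1)).1 with
  | none => exact absurd h (hω.late n hn hr)
  | some i => exact sub_le_sub_left (costMin_le c i) _

theorem sum_exploitBound_le (hc : ∀ i, 0 < c i) (hB : costMin c ≤ B) (hω : IsKubePath c B ω)
    (N : ℕ) :
    ∑ n ∈ range N, (if K ≤ n then exploitBound c (residual c B (hist n ω)) else 0) ≤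
      1 + (costMax c / costMin c) ^ 2 * Real.log (B / costMin c) := by
  have key : ∑ n ∈ range N, (if K ≤ n then exploitBound c (residual c B (hist n ω)) else 0) +
      exploitPotential c (residual c B (hist N ω)) ≤ exploitPotential c B := by
    induction N with
    | zero => simp [residual_hist_zero c B hω.zero]
    | succ N ih =>
      rw [Finset.sum_range_succ]
      refine le_trans ?_ ih
      rw [add_assoc]
      refine add_le_add_right ?_ _
      -- An initial step may make no pull, so there the budget need not drop by c_min; but it
      -- contributes nothing to the sum, and monotonicity of the potential suffices.
      split_ifs with hK
      · rcases lt_or_ge (residual c B (hist N ω)) (costMin c) with hr | hr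
        · rw [hω.residual_succ_of_lt hr, exploitBound, if_pos hr, zero_add]
        · exact exploitBound_add_exploitPotential_le hc hr (hω.residual_succ_of_late hK hr)
      · rw [zero_add]
        exact exploitPotential_mono hc (residual_hist_antitone hc B ω N.le_succ)
  have h1 := exploitPotential_nonneg hc (residual c B (hist N ω))
  have h2 : exploitPotential c B =
      1 + (costMax c / costMin c) ^ 2 * Real.log (B / costMin c) := by
    rw [exploitPotential, if_neg hB.not_gt]
  linarith

theorem exists_residual_lt (hc : ∀ i, 0 < c i) (hω : IsKubePath c B ω) :
    ∃ n, residual c B (hist n ω) < costMin c := by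
  by_contra! hcon
  have hcm := costMin_pos hc
  have key : ∀ k : ℕ, residual c B (hist (K + k) ω) ≤ residual c B (hist K ω) - k * costMin c := by
    intro k
    induction k with
    | zero => simp
    | succ k ih =>
      have := hω.residual_succ_of_late (Nat.le_add_right K k) (hcon _)
      rw [← add_assoc]
      push_cast
      linarith
  obtain ⟨k, hk⟩ := exists_nat_gt (residual c B (hist K ω) / costMin c)
  rw [div_lt_iff₀ hcm] at hk
  linarith [key k, hcon (K + k)]

omit [Nonempty (Fin K)] in
theorem sum_numPulls_mul_cost_le (hc : ∀ i, 0 < c i) (hB : 0 ≤ B) (hω : IsKubePath c B ω) :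
    ∑ i, numPulls i ω * ENNReal.ofReal (c i) ≤ ENNReal.ofReal B := by
  have hmono : ∀ i, Monotone fun n => (pullCount (hist n ω) i : ℝ≥0∞) := fun i =>
    monotone_nat_of_le_succ fun n => by rw [pullCount_hist_succ]; push_cast; exact le_self_add
  simp_rw [numPulls_eq_iSup hω.zero, ENNReal.iSup_mul]
  have hmono' : ∀ i, Monotone fun n =>
      (pullCount (hist n ω) i : ℝ≥0∞) * ENNReal.ofReal (c i) := fun i n n' h =>
    mul_le_mul_left (hmono i h) _
  rw [ENNReal.finsetSum_iSup_of_monotone hmono']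
  refine iSup_le fun n => ?_
  have h1 := hω.residual_nonneg hB n
  rw [residual, sub_nonneg] at h1
  refine le_trans (le_of_eq ?_) (ENNReal.ofReal_le_ofReal h1)
  rw [ENNReal.ofReal_sum_of_nonneg fun i _ => mul_nonneg (Nat.cast_nonneg _) (hc i).le]
  refine Finset.sum_congr rfl fun i _ => ?_
  rw [ENNReal.ofReal_mul (Nat.cast_nonneg _), ENNReal.ofReal_natCast]

theorem le_sum_numPulls_mul_cost (hc : ∀ i, 0 < c i) (hω : IsKubePath c B ω) :
    ENNReal.ofReal (B - costMin c) ≤ ∑ i, numPulls i ω * ENNReal.ofReal (c i) := by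
  obtain ⟨n, hn⟩ := hω.exists_residual_lt hc
  rw [residual] at hn
  refine le_trans (ENNReal.ofReal_le_ofReal (q := ∑ i, (pullCount (hist n ω) i : ℝ) * c i)
    (by linarith)) ?_
  rw [ENNReal.ofReal_sum_of_nonneg fun i _ => mul_nonneg (Nat.cast_nonneg _) (hc i).le]
  refine Finset.sum_le_sum fun i _ => ?_
  rw [ENNReal.ofReal_mul (Nat.cast_nonneg _), ENNReal.ofReal_natCast, numPulls_eq_iSup hω.zero]
  gcongr
  exact le_iSup (fun n => (pullCount (hist n ω) i : ℝ≥0∞)) n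

omit [Nonempty (Fin K)] in
theorem pullCount_eq_zero (hω : IsKubePath c B ω) (j : Fin K) {n : ℕ} (hn : n ≤ j) :
    pullCount (hist n ω) j = 0 := by
  induction n with
  | zero => exact pullCount_hist_zero hω.zero j
  | succ n ih =>
    rw [pullCount_hist_succ, ih (by omega), if_neg]
    intro h
    have := hω.initial_eq ⟨n, by omega⟩ j h
    rw [this] at hn
    simp at hn

omit [Nonempty (Fin K)] in
/-- In the initial phase an arm is pulled only if it has not been pulled before. -/
theorem pullCount_eq_zero_of_lt (hω : IsKubePath c B ω) {j : Fin K} {n : ℕ} (hn : n < K)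
    (hj : (ω (n + 1)).1 = some j) : pullCount (hist n ω) j = 0 := by
  have := hω.initial_eq ⟨n, hn⟩ j hj
  exact hω.pullCount_eq_zero j (by rw [this])

omit [Nonempty (Fin K)] in
theorem _root_.BudgetBandit.pullCount_hist_mono (ω : ℕ → Obs K) (i : Fin K) :
    Monotone fun n => pullCount (hist n ω) i :=
  monotone_nat_of_le_succ fun n => by rw [pullCount_hist_succ]; exact Nat.le_add_right _ _

omit [Nonempty (Fin K)] in
-- The residual budget only decreases, so if it covers c_max now, it covered every arm during the
-- initial round.
theorem one_le_pullCount (hc : ∀ i, 0 < c i) (hω : IsKubePath c B ω) {n : ℕ} (hn : K ≤ n)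
    (hr : costMax c ≤ residual c B (hist n ω)) (i : Fin K) : 1 ≤ pullCount (hist n ω) i := by
  have hin : (i : ℕ) + 1 ≤ n := le_trans i.2 hn
  have h1 : (ω (i + 1)).1 = some i := hω.initial i ((le_costMax c i).trans (hr.trans
    (residual_hist_antitone hc B ω (Nat.le_of_succ_le hin))))
  refine le_trans ?_ (pullCount_hist_mono ω i hin)
  simp [pullCount_hist_succ, h1]

/-- As long as every arm can be paid for, every step makes a pull. -/
theorem natCast_succ_le (hc : ∀ i, 0 < c i) (hω : IsKubePath c B ω) {n : ℕ}
    (hr : costMax c ≤ residual c B (hist n ω)) : (n : ℝ) + 1 ≤ B / costMin c := by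
  have hcm := costMin_pos hc
  have key : residual c B (hist n ω) ≤ B - n * costMin c := by
    induction n with
    | zero => simp [residual_hist_zero c B hω.zero]
    | succ n ih =>
      have hr' := hr.trans (residual_hist_antitone hc B ω n.le_succ)
      have h1 := ih hr'
      rw [residual_hist_succ]
      cases h : (ω (n + 1)).1 with
      | none =>
        exfalso
        rcases lt_or_ge n K with hn | hn
        · have := hω.initial ⟨n, hn⟩ ((le_costMax c _).trans hr')
          rw [h] at this
          exact absurd this (by simp)
        · exact hω.late n hn ((costMin_le_costMax c).trans hr') h
      | some i =>
        have := costMin_le c i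
        push_cast
        simp only [Option.elim]
        linarith
  -- The extra 1 comes from the remaining budget, which is still at least c_max ≥ c_min.
  rw [le_div_iff₀ hcm]
  have := costMin_le_costMax c
  linarith

end IsKubePath

/-- Each counted step raises the pull count truncated at `l` by one. -/
theorem tsum_pull_of_pullCount_lt_le {K : ℕ} (ω : ℕ → Obs K) (j : Fin K) (l : ℕ) :
    ∑' n : ℕ, (if pullCount (hist n ω) j < l ∧ (ω (n + 1)).1 = some j then 1 else 0 : ℝ≥0∞) ≤
      l := by
  rw [ENNReal.tsum_eq_iSup_nat]
  refine iSup_le fun N => ?_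
  have key : ∑ n ∈ range N,
      (if pullCount (hist n ω) j < l ∧ (ω (n + 1)).1 = some j then 1 else 0) ≤
        min (pullCount (hist N ω) j) l := by
    induction N with
    | zero => simp
    | succ N ih =>
      rw [Finset.sum_range_succ, pullCount_hist_succ]
      split_ifs <;> grind
  exact_mod_cast key.trans (min_le_right _ _)

section Gap

variable {K : ℕ} {c : Fin K → ℝ} {ν : Fin K → Measure ℝ} {I : Fin K}

theorem densityGap_le {j : Fin K} (hj : j ≠ I) :
    densityGap c ν I ≤ mean ν I / c I - mean ν j / c j :=
  ciInf_le (f := fun j : {j : Fin K // j ≠ I} => mean ν I / c I - mean ν j / c j)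
    (Set.finite_range _).bddBelow ⟨j, hj⟩

theorem densityGap_pos (hI : ∀ j, j ≠ I → mean ν j / c j < mean ν I / c I) {j : Fin K}
    (hj : j ≠ I) : 0 < densityGap c ν I := by
  have : Nonempty {j : Fin K // j ≠ I} := ⟨⟨j, hj⟩⟩
  obtain ⟨k, hk⟩ := exists_eq_ciInf_of_finite
    (f := fun j : {j : Fin K // j ≠ I} => mean ν I / c I - mean ν j / c j)
  rw [densityGap, ← hk]
  exact sub_pos.2 (hI k k.2)

end Gap

/-! ### Confidence bounds and deviations. -/

section Ucb

variable {K n : ℕ} {c : Fin K → ℝ} {ν : Fin K → Measure ℝ}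

/-- The average reward of arm `i` deviates from its mean by at least the confidence radius, upwards
for `r = 1` and downwards for `r = -1`. -/
def deviationSet (ν : Fin K → Measure ℝ) (i : Fin K) (r : ℝ) (n : ℕ) : Set (History K n) :=
  {h | 1 ≤ pullCount h i ∧ √(2 * pullCount h i * Real.log ((n : ℝ) + 1)) ≤
    r * (rewardSum h i - mean ν i * pullCount h i)}

theorem measurableSet_deviationSet (ν : Fin K → Measure ℝ) (i : Fin K) (r : ℝ) (n : ℕ) :
    MeasurableSet (deviationSet ν i r n) :=
  (measurableSet_le measurable_const (measurable_pullCount i)).inter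
    (measurableSet_le (((measurable_cast_pullCount i).const_mul _).mul_const _).sqrt
      (((measurable_rewardSum i).sub ((measurable_cast_pullCount i).const_mul _)).const_mul _))

theorem sqrt_two_mul_eq {k L : ℝ} (hk : 0 < k) : √(2 * k * L) = k * √(2 * L / k) := by
  rw [show 2 * k * L = k ^ 2 * (2 * L / k) by field_simp, Real.sqrt_mul (by positivity),
    Real.sqrt_sq hk.le]

theorem mean_lt_ucb {h : History K n} {i : Fin K} (hi : 1 ≤ pullCount h i)
    (hd : h ∉ deviationSet ν i (-1) n) : mean ν i < ucb h i := by
  have hk : (0 : ℝ) < pullCount h i := by exact_mod_cast hi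
  have h1 : ¬ _ := fun hle => hd ⟨hi, hle⟩
  rw [sqrt_two_mul_eq hk] at h1
  rw [ucb, ← mul_lt_mul_iff_right₀ hk, mul_add, mul_div_cancel₀ _ hk.ne']
  linarith

theorem ucb_lt_mean_add {h : History K n} {i : Fin K} (hi : 1 ≤ pullCount h i)
    (hd : h ∉ deviationSet ν i 1 n) :
    ucb h i < mean ν i + 2 * √(2 * Real.log ((n : ℝ) + 1) / pullCount h i) := by
  have hk : (0 : ℝ) < pullCount h i := by exact_mod_cast hi
  have h1 : ¬ _ := fun hle => hd ⟨hi, hle⟩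
  rw [sqrt_two_mul_eq hk] at h1
  rw [ucb, ← mul_lt_mul_iff_right₀ hk, mul_add, mul_div_cancel₀ _ hk.ne']
  linarith

/-- Without deviations, the upper bound of `I` exceeds its mean and that of `j` exceeds its mean by
less than two radii. If `j` still wins, the density gap is below two radii divided by c j ≥ 1, so
the radius is large and the pull count small. -/
theorem pullCount_lt_of_ucb_le (hc : ∀ i, 1 ≤ c i) {I j : Fin K} {d : ℝ} (hd : 0 < d)
    (hgap : d ≤ mean ν I / c I - mean ν j / c j) {h : History K n}
    (hI : 1 ≤ pullCount h I) (hj : 1 ≤ pullCount h j)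
    (hle : ucb h I / c I ≤ ucb h j / c j)
    (hdI : h ∉ deviationSet ν I (-1) n) (hdj : h ∉ deviationSet ν j 1 n) :
    (pullCount h j : ℝ) < 8 * Real.log ((n : ℝ) + 1) / d ^ 2 := by
  have hk : (0 : ℝ) < pullCount h j := by exact_mod_cast hj
  have hcI : 0 < c I := zero_lt_one.trans_le (hc I)
  have hcj : 0 < c j := zero_lt_one.trans_le (hc j)
  have hL : 0 ≤ Real.log ((n : ℝ) + 1) := Real.log_nonneg (by simp)
  set e := √(2 * Real.log ((n : ℝ) + 1) / pullCount h j) with he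
  have h1 : mean ν I / c I < mean ν j / c j + 2 * e / c j := by
    rw [← add_div]
    calc mean ν I / c I < ucb h I / c I := by gcongr; exact mean_lt_ucb hI hdI
      _ ≤ ucb h j / c j := hle
      _ < _ := by gcongr; exact ucb_lt_mean_add hj hdj
  have h2 : 2 * e / c j ≤ 2 * e := div_le_self (by positivity) (hc j)
  have h3 : d < 2 * e := by linarith
  have h4 : d ^ 2 < (2 * e) ^ 2 := by gcongr
  have he2 : e ^ 2 = 2 * Real.log ((n : ℝ) + 1) / pullCount h j := Real.sq_sqrt (by positivity)
  rw [mul_pow, he2, ← mul_div_assoc, lt_div_iff₀ hk] at h4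
  rw [lt_div_iff₀ (by positivity)]
  linarith

end Ucb

/-- The term n = 0 is left out because deviations matter only for n ≥ K ≥ 1; the resulting -1 is
needed for the final constant. -/
theorem tsum_ofReal_inv_sq_succ :
    ∑' n : ℕ, ENNReal.ofReal (if n = 0 then 0 else 1 / ((n : ℝ) + 1) ^ 2) =
      ENNReal.ofReal (Real.pi ^ 2 / 6 - 1) := by
  have h1 : HasSum (fun n : ℕ => 1 / ((n : ℝ) + 1) ^ 2) (Real.pi ^ 2 / 6) := by
    have := (hasSum_nat_add_iff' 1).2 hasSum_zeta_two
    simpa using this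
  have h2 : HasSum (fun n : ℕ => if n = 0 then (0 : ℝ) else 1 / ((n : ℝ) + 1) ^ 2)
      (Real.pi ^ 2 / 6 - 1) := by
    have := h1.sub (hasSum_ite_eq 0 (1 : ℝ))
    refine this.congr_fun fun n => ?_
    split_ifs with h
    · simp [h]
    · simp
  rw [← ENNReal.ofReal_tsum_of_nonneg _ h2.summable, h2.tsum_eq]
  intro n
  split_ifs <;> positivity

/-! ### Expected number of pulls of a suboptimal arm. -/

section PullBound

variable {K : ℕ} [Nonempty (Fin K)] {c : Fin K → ℝ} {B : ℝ} {A : Algorithm K}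
  {ν : Fin K → Measure ℝ} [∀ i, IsProbabilityMeasure (ν i)]

/-- Histories in which arm `j` does not have maximal estimated density, or in which not every arm
can be paid for. -/
def exploitSet (c : Fin K → ℝ) (B : ℝ) (j : Fin K) (n : ℕ) : Set (History K n) :=
  {h | residual c B h < costMax c ∨ ∃ i, ucb h j / c j < ucb h i / c i}

omit [Nonempty (Fin K)] in
theorem measurableSet_exploitSet (c : Fin K → ℝ) (B : ℝ) (j : Fin K) (n : ℕ) :
    MeasurableSet (exploitSet c B j n) := by
  refine (measurableSet_lt (measurable_residual c B) measurable_const).union ?_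
  exact measurableSet_setOfPred.2 (Measurable.exists fun i => measurableSet_setOfPred.1
    (measurableSet_lt ((measurable_ucb j).div_const _) ((measurable_ucb i).div_const _)))

omit [Nonempty (Fin K)] in
theorem measurableSet_hist_pull {n : ℕ} {E : Set (History K n)} (hE : MeasurableSet E)
    (j : Fin K) : MeasurableSet {ω | hist n ω ∈ E ∧ (ω (n + 1)).1 = some j} :=
  (measurable_hist n hE).inter ((measurableSet_singleton (some j)).preimage
    (measurable_fst.comp (measurable_pi_apply (n + 1))))

/-- Conditional probabilities replace the pulls, and after exchanging sum and expectation the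
potential bound applies on each path. -/
theorem tsum_law_exploit_le (hc : ∀ i, 0 < c i) (hB : costMin c ≤ B) (hA : IsKUBE c B A)
    (j : Fin K) :
    ∑' n : ℕ, law ν A {ω | K ≤ n ∧ hist n ω ∈ exploitSet c B j n ∧ (ω (n + 1)).1 = some j} ≤
      ENNReal.ofReal (1 + (costMax c / costMin c) ^ 2 * Real.log (B / costMin c)) := by
  let g : ℕ → (ℕ → Obs K) → ℝ := fun n ω =>
    if K ≤ n then exploitBound c (residual c B (hist n ω)) else 0
  have hg0 : ∀ n ω, 0 ≤ g n ω := fun n ω => by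
    dsimp only [g]
    split_ifs
    · exact exploitBound_nonneg hc _
    · exact le_rfl
  have hgm : ∀ n, Measurable (g n) := fun n => by
    dsimp only [g]
    split_ifs
    · have hr : Measurable fun ω : ℕ → Obs K => residual c B (hist n ω) :=
        (measurable_residual c B).comp (measurable_hist n)
      exact Measurable.ite (measurableSet_lt hr measurable_const) measurable_const
        (measurable_const.min (measurable_const.div (hr.div_const _)))
    · exact measurable_const
  calc _ ≤ ∑' n, ∫⁻ ω, ENNReal.ofReal (g n ω) ∂(law ν A) := by
        refine ENNReal.tsum_le_tsum fun n => ?_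
        by_cases hn : K ≤ n
        · simp only [hn, true_and, g, if_true]
          rw [lintegral_pull_indicator ν A n j (measurableSet_exploitSet c B j n)]
          refine lintegral_mono fun ω => ?_
          by_cases hω : hist n ω ∈ exploitSet c B j n
          · rw [Set.indicator_of_mem hω]
            exact hA.choose_le hc hn _ hω
          · rw [Set.indicator_of_notMem hω]
            exact zero_le
        · simp [hn]
    _ = ∫⁻ ω, ∑' n, ENNReal.ofReal (g n ω) ∂(law ν A) :=
        (lintegral_tsum fun n => (hgm n).ennreal_ofReal.aemeasurable).symm
    _ ≤ ∫⁻ _, ENNReal.ofReal (1 + (costMax c / costMin c) ^ 2 * Real.log (B / costMin c))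
          ∂(law ν A) := by
        refine lintegral_mono_ae ?_
        filter_upwards [hA.ae_isKubePath hc ν] with ω hω
        rw [ENNReal.tsum_eq_iSup_nat]
        refine iSup_le fun N => ?_
        rw [← ENNReal.ofReal_sum_of_nonneg fun n _ => hg0 n ω]
        exact ENNReal.ofReal_le_ofReal (hω.sum_exploitBound_le hc hB N)
    _ = _ := by simp

omit [Nonempty (Fin K)] in
theorem tsum_law_deviation_le (hν : ∀ i, ∀ᵐ x ∂(ν i), x ∈ Set.Icc (0 : ℝ) 1)
    (A : Algorithm K) (i : Fin K) {r : ℝ} (hr : r ^ 2 = 1) :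
    ∑' n : ℕ, law ν A {ω | K ≤ n ∧ hist n ω ∈ deviationSet ν i r n} ≤
      ENNReal.ofReal (Real.pi ^ 2 / 6 - 1) := by
  rw [← tsum_ofReal_inv_sq_succ]
  refine ENNReal.tsum_le_tsum fun n => ?_
  by_cases hn : K ≤ n
  · rw [if_neg (by have := i.pos; omega)]
    refine le_trans (measure_mono fun ω hω => ?_) (law_deviation_le hν A i hr n)
    exact hω.2
  · simp [hn]

/-- Expected number of pulls by KUBE of an arm that does not have the highest density. -/
theorem lintegral_numPulls_le (hc : ∀ i, 1 ≤ c i)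
    (hν : ∀ i, ∀ᵐ x ∂(ν i), x ∈ Set.Icc (0 : ℝ) 1) {I : Fin K}
    (hI : ∀ j, j ≠ I → mean ν j / c j < mean ν I / c I) (hB : costMin c ≤ B)
    (hA : IsKUBE c B A) {j : Fin K} (hj : j ≠ I) :
    ∫⁻ ω, numPulls j ω ∂(law ν A) ≤
      ENNReal.ofReal ((8 / densityGap c ν I ^ 2 + (costMax c / costMin c) ^ 2) *
        Real.log (B / costMin c) + Real.pi ^ 2 / 3) := by
  have hc0 : ∀ i, 0 < c i := fun i => zero_lt_one.trans_le (hc i)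
  have hcm := costMin_pos hc0
  set d := densityGap c ν I with hd
  have hd0 : 0 < d := densityGap_pos hI hj
  set b := B / costMin c with hb
  have hb1 : 1 ≤ b := (one_le_div hcm).2 hB
  have hlb : 0 ≤ Real.log b := Real.log_nonneg hb1
  set l := ⌊8 * Real.log b / d ^ 2⌋₊ + 1 with hl
  have hl1 : (l : ℝ) ≤ 8 * Real.log b / d ^ 2 + 1 := by
    rw [hl]; push_cast
    gcongr
    exact Nat.floor_le (by positivity)
  let S2 : ℕ → Set (ℕ → Obs K) := fun n =>
    {ω | K ≤ n ∧ hist n ω ∈ exploitSet c B j n ∧ (ω (n + 1)).1 = some j}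
  let S3 : ℕ → Set (ℕ → Obs K) := fun n => {ω | K ≤ n ∧ hist n ω ∈ deviationSet ν I (-1) n}
  let S4 : ℕ → Set (ℕ → Obs K) := fun n => {ω | K ≤ n ∧ hist n ω ∈ deviationSet ν j 1 n}
  have hS2 : ∀ n, MeasurableSet (S2 n) := fun n =>
    (MeasurableSet.const _).inter (measurableSet_hist_pull (measurableSet_exploitSet c B j n) j)
  have hS3 : ∀ n, MeasurableSet (S3 n) := fun n =>
    (MeasurableSet.const _).inter (measurable_hist n (measurableSet_deviationSet ν I _ n))
  have hS4 : ∀ n, MeasurableSet (S4 n) := fun n =>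
    (MeasurableSet.const _).inter (measurable_hist n (measurableSet_deviationSet ν j _ n))
  let f : ℕ → (ℕ → Obs K) → ℝ≥0∞ := fun n ω =>
    (S2 n).indicator 1 ω + ((S3 n).indicator 1 ω + (S4 n).indicator 1 ω)
  have hpath : ∀ᵐ ω ∂(law ν A), numPulls j ω ≤ (l : ℝ≥0∞) + ∑' n, f n ω := by
    filter_upwards [hA.ae_isKubePath hc0 ν] with ω hω
    refine le_trans ?_ (add_le_add_left (tsum_pull_of_pullCount_lt_le ω j l) _)
    rw [numPulls, ← ENNReal.tsum_add]
    refine ENNReal.tsum_le_tsum fun n => ?_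
    by_cases hp : (ω (n + 1)).1 = some j
    swap
    · simp [hp]
    rw [if_pos hp]
    by_cases hcnt : pullCount (hist n ω) j < l
    · rw [if_pos ⟨hcnt, hp⟩]
      exact le_self_add
    refine le_add_left ?_
    -- A pull in the initial round happens at pull count 0 < l and is already among the first `l`.
    have hn : K ≤ n := by
      by_contra hn
      rw [hω.pullCount_eq_zero_of_lt (not_le.1 hn) hp] at hcnt
      omega
    by_cases h2 : ω ∈ S2 n
    · simp only [f]
      rw [Set.indicator_of_mem h2]
      exact le_self_add
    by_cases h3 : ω ∈ S3 n
    · simp only [f]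
      rw [Set.indicator_of_mem h3]
      exact le_add_left le_self_add
    by_cases h4 : ω ∈ S4 n
    · simp only [f]
      rw [Set.indicator_of_mem h4]
      exact le_add_left le_add_self
    exfalso
    -- Outside this set every arm is affordable, so both arms have been sampled and n + 1 ≤ B/c_min,
    -- and `j` has maximal estimated density.
    have hE : hist n ω ∉ exploitSet c B j n := fun h => h2 ⟨hn, h, hp⟩
    simp only [exploitSet, Set.mem_ofPred_eq, not_or, not_exists, not_lt] at hE
    have hlt := pullCount_lt_of_ucb_le hc hd0 (densityGap_le hj)
      (hω.one_le_pullCount hc0 hn hE.1 I) (hω.one_le_pullCount hc0 hn hE.1 j) (hE.2 I)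
      (fun h => h3 ⟨hn, h⟩) (fun h => h4 ⟨hn, h⟩)
    have hlog : Real.log ((n : ℝ) + 1) ≤ Real.log b :=
      Real.log_le_log (by positivity) (hω.natCast_succ_le hc0 hE.1)
    have h5 : (pullCount (hist n ω) j : ℝ) < 8 * Real.log b / d ^ 2 :=
      hlt.trans_le (by gcongr)
    have h6 := Nat.lt_floor_add_one (8 * Real.log b / d ^ 2)
    have h7 : (l : ℝ) ≤ pullCount (hist n ω) j := by exact_mod_cast not_lt.1 hcnt
    rw [hl] at h7
    push_cast at h7
    linarith
  have hfi : ∀ n, ∫⁻ ω, f n ω ∂(law ν A) =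
      law ν A (S2 n) + (law ν A (S3 n) + law ν A (S4 n)) := fun n => by
    simp only [f]
    rw [lintegral_add_left (measurable_one.indicator (hS2 n)),
      lintegral_add_left (measurable_one.indicator (hS3 n)), lintegral_indicator_one (hS2 n),
      lintegral_indicator_one (hS3 n), lintegral_indicator_one (hS4 n)]
  have hfm : ∀ n, Measurable (f n) := fun n => (measurable_one.indicator (hS2 n)).add
    ((measurable_one.indicator (hS3 n)).add (measurable_one.indicator (hS4 n)))
  have hpi : 0 ≤ Real.pi ^ 2 / 6 - 1 := by nlinarith [Real.pi_gt_three]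
  calc _ ≤ ∫⁻ ω, ((l : ℝ≥0∞) + ∑' n, f n ω) ∂(law ν A) := lintegral_mono_ae hpath
    _ = l + ∑' n, ∫⁻ ω, f n ω ∂(law ν A) := by
        rw [lintegral_add_left measurable_const, lintegral_tsum fun n => (hfm n).aemeasurable]
        simp
    _ = l + (∑' n, law ν A (S2 n) + (∑' n, law ν A (S3 n) + ∑' n, law ν A (S4 n))) := by
        simp_rw [hfi]
        rw [ENNReal.tsum_add, ENNReal.tsum_add]
    _ ≤ ENNReal.ofReal (8 * Real.log b / d ^ 2 + 1) +
        (ENNReal.ofReal (1 + (costMax c / costMin c) ^ 2 * Real.log b) +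
          (ENNReal.ofReal (Real.pi ^ 2 / 6 - 1) + ENNReal.ofReal (Real.pi ^ 2 / 6 - 1))) := by
        gcongr
        · rw [← ENNReal.ofReal_natCast]
          exact ENNReal.ofReal_le_ofReal hl1
        · exact tsum_law_exploit_le hc0 hB hA j
        · exact tsum_law_deviation_le hν A I (by norm_num)
        · exact tsum_law_deviation_le hν A j (by norm_num)
    -- The +1 from rounding in `l` and the +1 from the potential cancel the two -1 of the deviation
    -- sums.
    _ = _ := by
        rw [← ENNReal.ofReal_add hpi hpi, ← ENNReal.ofReal_add (by positivity) (by positivity),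
          ← ENNReal.ofReal_add (by positivity) (by positivity)]
        congr 1
        ring

end PullBound

/-! ### From pull counts to regret. -/

section Regret

variable {K : ℕ} [Nonempty (Fin K)] {c : Fin K → ℝ} {B : ℝ} {A : Algorithm K}
  {ν : Fin K → Measure ℝ} [∀ i, IsProbabilityMeasure (ν i)]

theorem IsKUBE.respectsBudget (hc : ∀ i, 0 < c i) (hB : 0 ≤ B) (hA : IsKUBE c B A) :
    RespectsBudget c ν B A := by
  filter_upwards [hA.ae_isKubePath hc ν] with ω hω
  exact hω.sum_numPulls_mul_cost_le hc hB

/-- After the initial round each step spends at least c_min while it can, so the residual budget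
eventually drops below c_min on almost every path. -/
theorem IsKUBE.le_sum_cost (hc : ∀ i, 0 < c i) (hB : 0 ≤ B) (hA : IsKUBE c B A) :
    B - costMin c ≤ ∑ i, (∫⁻ ω, numPulls i ω ∂(law ν A)).toReal * c i := by
  have h1 : ENNReal.ofReal (B - costMin c) ≤
      ∑ i, (∫⁻ ω, numPulls i ω ∂(law ν A)) * ENNReal.ofReal (c i) := by
    calc _ = ∫⁻ _, ENNReal.ofReal (B - costMin c) ∂(law ν A) := by simp
      _ ≤ ∫⁻ ω, ∑ i, numPulls i ω * ENNReal.ofReal (c i) ∂(law ν A) := by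
          refine lintegral_mono_ae ?_
          filter_upwards [hA.ae_isKubePath hc ν] with ω hω
          exact hω.le_sum_numPulls_mul_cost hc
      _ = _ := by
          rw [lintegral_finsetSum _ fun i _ => (measurable_numPulls i).mul_const _]
          exact Finset.sum_congr rfl fun i _ => lintegral_mul_const _ (measurable_numPulls i)
  have h2 : ∀ i, (∫⁻ ω, numPulls i ω ∂(law ν A)) * ENNReal.ofReal (c i) =
      ENNReal.ofReal ((∫⁻ ω, numPulls i ω ∂(law ν A)).toReal * c i) := fun i => by
    rw [ENNReal.ofReal_mul ENNReal.toReal_nonneg,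
      ENNReal.ofReal_toReal (lintegral_numPulls_ne_top hc (hA.respectsBudget hc hB) i)]
  have h0 : ∀ i ∈ Finset.univ, 0 ≤ (∫⁻ ω, numPulls i ω ∂(law ν A)).toReal * c i :=
    fun i _ => mul_nonneg ENNReal.toReal_nonneg (hc i).le
  simp_rw [h2] at h1
  rw [← ENNReal.ofReal_sum_of_nonneg h0] at h1
  exact (ENNReal.ofReal_le_ofReal_iff (Finset.sum_nonneg h0)).1 h1

omit [Nonempty (Fin K)] in
theorem toReal_expectedReward (hc : ∀ i, 0 < c i)
    (hν : ∀ i, ∀ᵐ x ∂(ν i), x ∈ Set.Icc (0 : ℝ) 1) (hA : RespectsBudget c ν B A) :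
    (expectedReward ν A).toReal =
      ∑ i, mean ν i * (∫⁻ ω, numPulls i ω ∂(law ν A)).toReal := by
  rw [expectedReward_eq hν, ENNReal.toReal_sum fun i _ =>
    ENNReal.mul_ne_top ENNReal.ofReal_ne_top (lintegral_numPulls_ne_top hc hA i)]
  refine Finset.sum_congr rfl fun i _ => ?_
  rw [ENNReal.toReal_mul, ENNReal.toReal_ofReal (mean_nonneg hν i)]

omit [Nonempty (Fin K)] in
theorem gapSum_eq (c : Fin K → ℝ) (ν : Fin K → Measure ℝ) (I : Fin K) :
    gapSum c ν I = ∑ j, ((if 0 < mean ν I - mean ν j then mean ν I - mean ν j else 0) +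
      if 0 < c j - c I then (c j - c I) / c I else 0) := by
  rw [gapSum, Finset.sum_filter, Finset.sum_filter, Finset.sum_add_distrib]

omit [Nonempty (Fin K)] in
theorem gapSum_nonneg (hc : ∀ i, 0 < c i) (ν : Fin K → Measure ℝ) (I : Fin K) :
    0 ≤ gapSum c ν I := by
  have := hc I
  rw [gapSum_eq]
  refine Finset.sum_nonneg fun j _ => add_nonneg ?_ ?_
  · split_ifs with h
    exacts [h.le, le_rfl]
  · split_ifs with h
    exacts [by positivity, le_rfl]

theorem IsKUBE.regret_le (hc : ∀ i, 1 ≤ c i)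
    (hν : ∀ i, ∀ᵐ x ∂(ν i), x ∈ Set.Icc (0 : ℝ) 1) {I : Fin K}
    (hI : ∀ j, j ≠ I → mean ν j / c j < mean ν I / c I) (hB : costMin c ≤ B)
    (hA : IsKUBE c B A) :
    regret c ν B A ≤ gapSum c ν I * ((8 / densityGap c ν I ^ 2 + (costMax c / costMin c) ^ 2) *
      Real.log (B / costMin c) + Real.pi ^ 2 / 3) + 1 := by
  have hc0 : ∀ i, 0 < c i := fun i => zero_lt_one.trans_le (hc i)
  have hcm := costMin_pos hc0
  have hB0 : 0 ≤ B := hcm.le.trans hB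
  have hI' : ∀ j, mean ν j / c j ≤ mean ν I / c I := fun j => by
    by_cases hj : j = I
    · rw [hj]
    · exact (hI j hj).le
  have hcI := hc0 I
  have hlog : 0 ≤ Real.log (B / costMin c) := Real.log_nonneg ((one_le_div hcm).2 hB)
  set M := (8 / densityGap c ν I ^ 2 + (costMax c / costMin c) ^ 2) *
    Real.log (B / costMin c) + Real.pi ^ 2 / 3 with hM
  -- This covers K = 1 too: the infimum defining the gap is then over an empty type, hence 0, and
  -- 8/0 = 0.
  have hM0 : 0 ≤ M := by positivity
  set D := mean ν I / c I with hD
  have hD0 : 0 ≤ D := div_nonneg (mean_nonneg hν I) hcI.le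
  have hD1 : D ≤ 1 / c I := div_le_div_of_nonneg_right (mean_le_one hν I) hcI.le
  have hDI : D * c I = mean ν I := div_mul_cancel₀ _ hcI.ne'
  have hopt : (optimalReward c ν B).toReal ≤ D * B :=
    ENNReal.toReal_le_of_le_ofReal (mul_nonneg hD0 hB0) (optimalReward_le hc0 hν hI' B)
  have hcost := hA.le_sum_cost (ν := ν) hc0 hB0
  rw [regret, toReal_expectedReward hc0 hν (hA.respectsBudget hc0 hB0)]
  set x : Fin K → ℝ := fun i => (∫⁻ ω, numPulls i ω ∂(law ν A)).toReal with hx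
  have hx0 : ∀ i, 0 ≤ x i := fun i => ENNReal.toReal_nonneg
  have hxM : ∀ j, j ≠ I → x j ≤ M := fun j hj =>
    ENNReal.toReal_le_of_le_ofReal hM0 (lintegral_numPulls_le hc hν hI hB hA hj)
  set w : Fin K → ℝ := fun j =>
    (if 0 < mean ν I - mean ν j then mean ν I - mean ν j else 0) +
      if 0 < c j - c I then (c j - c I) / c I else 0 with hw
  have hterm : ∀ j, x j * (D * c j - mean ν j) ≤ w j * M := by
    intro j
    by_cases hj : j = I
    · subst hj
      simp [hw, hDI]
    have h1 : D * c j - mean ν j = (mean ν I - mean ν j) + D * (c j - c I) := by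
      rw [mul_sub, hDI]; ring
    have h2 : mean ν I - mean ν j ≤
        if 0 < mean ν I - mean ν j then mean ν I - mean ν j else 0 := by
      split_ifs with h
      exacts [le_rfl, not_lt.1 h]
    have h3 : D * (c j - c I) ≤ if 0 < c j - c I then (c j - c I) / c I else 0 := by
      split_ifs with h
      · rw [div_eq_mul_one_div, mul_comm D]
        gcongr
      · exact mul_nonpos_of_nonneg_of_nonpos hD0 (not_lt.1 h)
    have h4 : 0 ≤ D * c j - mean ν j := by
      rw [sub_nonneg, ← div_le_iff₀ (hc0 j)]; exact hI' j
    have h5 : D * c j - mean ν j ≤ w j := by rw [h1]; exact add_le_add h2 h3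
    rw [mul_comm (w j)]
    exact mul_le_mul (hxM j hj) h5 h4 hM0
  have hsum := Finset.sum_le_sum fun j (_ : j ∈ Finset.univ) => hterm j
  rw [← Finset.sum_mul, ← gapSum_eq] at hsum
  have hexp : ∑ j, x j * (D * c j - mean ν j) = D * ∑ j, x j * c j - ∑ j, mean ν j * x j := by
    rw [Finset.mul_sum, ← Finset.sum_sub_distrib]
    exact Finset.sum_congr rfl fun j _ => by ring
  have h6 : D * (B - costMin c) ≤ D * ∑ j, x j * c j := mul_le_mul_of_nonneg_left hcost hD0
  -- The value of the unspent budget, the source of the additive 1.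
  have h7 : D * costMin c ≤ 1 :=
    (mul_le_mul_of_nonneg_left (costMin_le c I) hD0).trans (hDI ▸ mean_le_one hν I)
  rw [mul_sub] at h6
  linarith

omit [Nonempty (Fin K)] in
theorem regret_nonneg (hopt : optimalReward c ν B ≠ ∞) (hA : RespectsBudget c ν B A) :
    0 ≤ regret c ν B A :=
  sub_nonneg.2 (ENNReal.toReal_mono hopt
    (le_iSup₂ (f := fun (A : Algorithm K) (_ : RespectsBudget c ν B A) => expectedReward ν A)
      A hA))

end Regret

end BudgetBandit

theorem theorem1 {K : ℕ} (c : Fin K → ℝ) (hc : ∀ i, 1 ≤ c i)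
    (ν : Fin K → MeasureTheory.Measure ℝ) [∀ i, MeasureTheory.IsProbabilityMeasure (ν i)]
    (hν : ∀ i, ∀ᵐ x ∂(ν i), x ∈ Set.Icc (0 : ℝ) 1)
    (Istar : Fin K)
    (hIstar : ∀ j, j ≠ Istar →
      BudgetBandit.mean ν j / c j < BudgetBandit.mean ν Istar / c Istar)
    (kube : ℝ → BudgetBandit.Algorithm K)
    (hkube : ∀ B, BudgetBandit.costMin c ≤ B → BudgetBandit.IsKUBE c B (kube B)) :
    (∀ B, BudgetBandit.costMin c ≤ B →
      BudgetBandit.RespectsBudget c ν B (kube B) ∧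
      BudgetBandit.optimalReward c ν B ≠ ⊤ ∧
      BudgetBandit.regret c ν B (kube B) ≤
        (8 / BudgetBandit.densityGap c ν Istar ^ 2 +
            (BudgetBandit.costMax c / BudgetBandit.costMin c) ^ 2) *
          BudgetBandit.gapSum c ν Istar * Real.log (B / BudgetBandit.costMin c) +
        BudgetBandit.gapSum c ν Istar * (Real.pi ^ 2 / 3 + 1) + 1) ∧
    (fun B => BudgetBandit.regret c ν B (kube B)) =O[Filter.atTop] (fun B => Real.log B) := by
  have : Nonempty (Fin K) := ⟨Istar⟩
  have hc0 : ∀ i, 0 < c i := fun i => zero_lt_one.trans_le (hc i)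
  have hcm := BudgetBandit.costMin_pos hc0
  have hI : ∀ j, BudgetBandit.mean ν j / c j ≤ BudgetBandit.mean ν Istar / c Istar := fun j => by
    by_cases hj : j = Istar
    · rw [hj]
    · exact (hIstar j hj).le
  have hresp : ∀ B, BudgetBandit.costMin c ≤ B → BudgetBandit.RespectsBudget c ν B (kube B) :=
    fun B hB => (hkube B hB).respectsBudget hc0 (hcm.le.trans hB)
  have hopt : ∀ B, BudgetBandit.optimalReward c ν B ≠ ⊤ := fun B =>
    ne_top_of_le_ne_top ENNReal.ofReal_ne_top (BudgetBandit.optimalReward_le hc0 hν hI B)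
  have hgap := BudgetBandit.gapSum_nonneg hc0 ν Istar
  have hreg := fun B hB => (hkube B hB).regret_le hc hν hIstar hB
  refine ⟨fun B hB => ⟨hresp B hB, hopt B, ?_⟩, ?_⟩
  · have := hreg B hB
    linarith
  · set g := BudgetBandit.gapSum c ν Istar
    set a := 8 / BudgetBandit.densityGap c ν Istar ^ 2 +
      (BudgetBandit.costMax c / BudgetBandit.costMin c) ^ 2
    have ha0 : 0 ≤ a := by positivity
    -- For B ≥ e the logarithm is at least 1 and absorbs the constants; c_min ≥ 1 gives ln(B/c_min)
    -- ≤ ln B.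
    refine Asymptotics.IsBigO.of_bound (g * (a + Real.pi ^ 2 / 3) + 1) ?_
    filter_upwards [Filter.eventually_ge_atTop (BudgetBandit.costMin c),
      Filter.eventually_ge_atTop (Real.exp 1)] with B hB hBe
    have hB0 : 0 < B := hcm.trans_le hB
    have hlog1 : 1 ≤ Real.log B := (Real.le_log_iff_exp_le hB0).2 hBe
    obtain ⟨i, hi⟩ := BudgetBandit.exists_costMin_eq c
    have hlog : Real.log (B / BudgetBandit.costMin c) ≤ Real.log B :=
      Real.log_le_log (div_pos hB0 hcm) (div_le_self hB0.le (hi ▸ hc i))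
    rw [Real.norm_of_nonneg (BudgetBandit.regret_nonneg (hopt B) (hresp B hB)),
      Real.norm_of_nonneg (zero_le_one.trans hlog1)]
    refine (hreg B hB).trans ?_
    have h1 : a * Real.log (B / BudgetBandit.costMin c) + Real.pi ^ 2 / 3 ≤
        (a + Real.pi ^ 2 / 3) * Real.log B := by
      rw [add_mul a]
      exact add_le_add (mul_le_mul_of_nonneg_left hlog ha0)
        (le_mul_of_one_le_right (by positivity) hlog1)
    have h2 := mul_le_mul_of_nonneg_left h1 hgap
    rw [add_mul (g * _), mul_assoc g, one_mul]
    linarith
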